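/- **Theorem (convergence of the objective functionals of learning problems).** Let $T>0$, $p\in[1,\infty)$, $\beta_1,\beta_2,\beta_3\ge 0$, $b\in\mathbb R^m$, $x^0,y\in\mathbb R^n$. Let $\|\cdot\|_2$ be the Euclidean norm on vectors and the spectral norm on matrices, and let $\partial\mathcal R$ denote the convex subdifferential of $\mathcal R$. Assume: - (A1) $\mathcal R:\mathbb R^n\to\mathbb R$ is convex; - (A2) $0\in\partial\mathcal R(0)$; - (A3) there is $M>0$ such that for each $x\in\mathbb R^n$ either $\|z\|_2\le M\|x\|_2$ for all $z\in\partial\mathcal R(x)$, or $\|z\|_2\le M$ for all $z\in\partial\mathcal R(x)$; - (A4) $\mathcal L:\mathbb R^n\times\mathbb R^n\to\mathbb R$ is continuous and nonnegative; - (A5) $\psi:\mathbb R\to[0,\infty)$ is locally Lipschitz. *Discrete objective.* For $N\ge1$ and $A=(A^k)_{k=0}^{N-1}\subset\mathbb R^{m\times n}$, $\alpha=(\alpha^k)_{k=0}^{N-1}\subset[0,\infty)$, $\lambda=(\lambda^k)_{k=0}^{N-1}\subset[0,\infty)$, let $(x^{N,k})_{k=0}^N$ be the state of the $N$-layer FBS-network,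 $$x^{N,0}=x^0,\qquad 0\in x^{N,k+1}-x^{N,k}+\tfrac TN\alpha^k(A^k)^\top(A^kx^{N,k}-b)+\tfrac TN\alpha^k\lambda^k\,\partial\mathcal R(x^{N,k+1}),\quad 0\le k<N,$$ and put $$\mathcal J_N(A,\alpha,\lambda)=\mathcal L(x^{N,N},y)+\beta_1\psi\Big(\tfrac1N\sum_{k}\|A^k\|_2^p\Big)+\beta_2\psi\Big(\tfrac1N\sum_k|\alpha^k|^p\Big)+\beta_3\psi\Big(\tfrac1N\sum_k|\lambda^k|^p\Big).$$ *Continuous objective.* For $(\mathbf A,\boldsymbol\alpha,\boldsymbol\lambda)\in L^\infty([0,T];\mathbb R^{m\times n}\times\mathbb R\times\mathbb R)$ with $\boldsymbol\alpha,\boldsymbol\lambda\ge0$ a.e., let $\mathbf x$ be the absolutely continuous solution on $[0,T]$ of $$\mathbf x(0)=x^0,\qquad 0\in\dot{\mathbf x}(t)+\boldsymbol\alpha(t)\mathbf A(t)^\top(\mathbf A(t)\mathbf x(t)-b)+\boldsymbol\alpha(t)\boldsymbol\lambda(t)\,\partial\mathcal R(\mathbf x(t))\quad\text{for a.e. }t\in[0,T],$$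 and put $$\mathcal J(\mathbf A,\boldsymbol\alpha,\boldsymbol\lambda)=\mathcal L(\mathbf x(T),y)+\beta_1\psi\Big(\tfrac1T\int_0^T\|\mathbf A\|_2^p\,dt\Big)+\beta_2\psi\Big(\tfrac1T\int_0^T|\boldsymbol\alpha|^p\,dt\Big)+\beta_3\psi\Big(\tfrac1T\int_0^T|\boldsymbol\lambda|^p\,dt\Big).$$ *Projection.* Let $\mathcal P_N$ send an integrable function $V$ on $[0,T]$ to the vector of its averages over the $N$ intervals of length $T/N$ of the uniform partition of $[0,T]$, and let $(\mathcal J_N\circ\mathcal P_N)(\mathbf A,\boldsymbol\alpha,\boldsymbol\lambda)=\mathcal J_N(\mathcal P_N\mathbf A,\mathcal P_N\boldsymbol\alpha,\mathcal P_N\boldsymbol\lambda)$. Let $\mathscr F\subset L^\infty([0,T];\mathbb R^{m\times n}\times\mathbb R\times\mathbb R)$, where $\mathbb R^{m\times n}\times\mathbb R\times\mathbb R$ has the norm $\|U\|_2+|\eta|+|\zeta|$, be nonempty and bounded, with $\boldsymbol\alpha\ge0$ and $\boldsymbol\lambda\ge0$ a.e. for all $(\mathbf A,\boldsymbol\alpha,\boldsymbol\lambda)\in\mathscr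 F$. Then: 1. for every $(\mathbf A,\boldsymbol\alpha,\boldsymbol\lambda)\in\mathscr F$ the differential inclusion has exactly one absolutely continuous solution on $[0,T]$, and for every $N\ge1$ the network with parameters $(\mathcal P_N\mathbf A,\mathcal P_N\boldsymbol\alpha,\mathcal P_N\boldsymbol\lambda)$ has exactly one state, so that $\mathcal J$ and $\mathcal J_N\circ\mathcal P_N$ are well defined on $\mathscr F$; 2. for every $(\widetilde{\mathbf A},\widetilde{\boldsymbol\alpha},\widetilde{\boldsymbol\lambda})\in\mathscr F$ and every sequence $(\mathbf A^{(N)},\boldsymbol\alpha^{(N)},\boldsymbol\lambda^{(N)})_{N\ge1}$ in $\mathscr F$ that converges to it in $L^p([0,T];\mathbb R^{m\times n}\times\mathbb R\times\mathbb R)$, $$\lim_{N\to\infty}(\mathcal J_N\circ\mathcal P_N)(\mathbf A^{(N)},\boldsymbol\alpha^{(N)},\boldsymbol\lambda^{(N)})=\mathcal J(\widetilde{\mathbf A},\widetilde{\boldsymbol\alpha},\widetilde{\boldsymbol\lambda}).$$ -/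

import Mathlib

open MeasureTheory Filter Topology
open scoped ENNReal RealInnerProductSpace Matrix.Norms.L2Operator

noncomputable section

namespace FBS

/-- The state space `ℝⁿ` with the Euclidean norm. -/
abbrev Vec (n : ℕ) : Type := EuclideanSpace ℝ (Fin n)

/-- The matrices `ℝ^{m × n}`; their norm is the spectral norm. -/
abbrev Mat (m n : ℕ) : Type := Matrix (Fin m) (Fin n) ℝ

/-- The convex subdifferential of `R` at `x`. -/
def subdiff {n : ℕ} (R : Vec n → ℝ) (x : Vec n) : Set (Vec n) :=
  {z | ∀ w : Vec n, R x + ⟪z, w - x⟫ ≤ R w}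

/-- `Aᵀ (A x - b)`. -/
def gradTerm {m n : ℕ} (A : Mat m n) (b : Vec m) (x : Vec n) : Vec n :=
  Matrix.toEuclideanLin A.transpose (Matrix.toEuclideanLin A x - b)

/-- `x 0, …, x N` is a state of the `N`-layer network with parameters `A`, `α`, `lam`
(step size `T / N`) and initial value `x0`. -/
def IsNetworkState {m n : ℕ} (R : Vec n → ℝ) (T : ℝ) (b : Vec m) (x0 : Vec n) {N : ℕ}
    (A : Fin N → Mat m n) (α lam : Fin N → ℝ) (x : Fin (N + 1) → Vec n) : Prop :=
  x 0 = x0 ∧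
    ∀ k : Fin N, ∃ z ∈ subdiff R (x k.succ),
      x k.succ - x k.castSucc + (T / N * α k) • gradTerm (A k) b (x k.castSucc)
        + (T / N * α k * lam k) • z = 0

/-- `x` is an absolutely continuous solution on `[0, T]` of the differential inclusion
`x' + α Aᵀ (A x - b) + α lam ∂R(x) ∋ 0` a.e., `x(0) = x0`. -/
def IsLimitState {m n : ℕ} (R : Vec n → ℝ) (T : ℝ) (b : Vec m) (x0 : Vec n)
    (A : ℝ → Mat m n) (α lam : ℝ → ℝ) (x : ℝ → Vec n) : Prop :=
  AbsolutelyContinuousOnInterval x 0 T ∧ x 0 = x0 ∧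
    ∀ᵐ t ∂(volume.restrict (Set.Icc 0 T)), ∃ v : Vec n, HasDerivAt x v t ∧
      ∃ z ∈ subdiff R (x t), v + α t • gradTerm (A t) b (x t) + (α t * lam t) • z = 0

/-- The network state (some state; the theorem asserts that there is exactly one). -/
def networkState {m n : ℕ} (R : Vec n → ℝ) (T : ℝ) (b : Vec m) (x0 : Vec n) {N : ℕ}
    (A : Fin N → Mat m n) (α lam : Fin N → ℝ) : Fin (N + 1) → Vec n :=
  Classical.epsilon (IsNetworkState R T b x0 A α lam)

/-- The state of the differential inclusion (some solution; the theorem asserts that there is one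
and that it is unique on `[0, T]`). -/
def limitState {m n : ℕ} (R : Vec n → ℝ) (T : ℝ) (b : Vec m) (x0 : Vec n)
    (A : ℝ → Mat m n) (α lam : ℝ → ℝ) : ℝ → Vec n :=
  Classical.epsilon (IsLimitState R T b x0 A α lam)

/-- The discrete regularizer `ψ ((1/N) ∑ₖ ‖Vₖ‖ᵖ)`. -/
def discreteReg {X : Type*} [Norm X] (ψ : ℝ → ℝ) (p : ℝ) {N : ℕ} (V : Fin N → X) : ℝ :=
  ψ (1 / N * ∑ k, ‖V k‖ ^ p)

/-- The continuous regularizer `ψ ((1/T) ∫₀ᵀ ‖V t‖ᵖ dt)`. -/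
def contReg {X : Type*} [Norm X] (ψ : ℝ → ℝ) (p T : ℝ) (V : ℝ → X) : ℝ :=
  ψ (1 / T * ∫ t in Set.Icc 0 T, ‖V t‖ ^ p)

/-- The objective `𝒥_N` of the `N`-layer network. -/
def discreteObjective {m n : ℕ} (R : Vec n → ℝ) (L : Vec n → Vec n → ℝ) (ψ : ℝ → ℝ)
    (p T β₁ β₂ β₃ : ℝ) (b : Vec m) (x0 y : Vec n) {N : ℕ}
    (A : Fin N → Mat m n) (α lam : Fin N → ℝ) : ℝ :=
  L (networkState R T b x0 A α lam (Fin.last N)) y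
    + β₁ * discreteReg ψ p A + β₂ * discreteReg ψ p α + β₃ * discreteReg ψ p lam

/-- The objective `𝒥` of the deep-layer limit system. -/
def contObjective {m n : ℕ} (R : Vec n → ℝ) (L : Vec n → Vec n → ℝ) (ψ : ℝ → ℝ)
    (p T β₁ β₂ β₃ : ℝ) (b : Vec m) (x0 y : Vec n)
    (A : ℝ → Mat m n) (α lam : ℝ → ℝ) : ℝ :=
  L (limitState R T b x0 A α lam T) y
    + β₁ * contReg ψ p T A + β₂ * contReg ψ p T α + β₃ * contReg ψ p T lam

/-- The `k`-th cell of the uniform partition of `[0, T]` into `N` intervals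
(half-open, the last one closed). -/
def cell (T : ℝ) (N : ℕ) (k : Fin N) : Set ℝ :=
  if (k : ℕ) + 1 = N then Set.Icc (k * (T / N)) T
  else Set.Ico (k * (T / N)) ((k + 1) * (T / N))

/-- The projection `𝒫_N`: averages over the cells. -/
def proj {X : Type*} [NormedAddCommGroup X] [NormedSpace ℝ X] (T : ℝ) (N : ℕ) (V : ℝ → X) :
    Fin N → X :=
  fun k => ⨍ s in cell T N k, V s

/-- `ℝ^{m × n} × ℝ × ℝ` with the norm `‖U‖₂ + |η| + |ζ|`. -/
abbrev Param (m n : ℕ) : Type := WithLp 1 (Mat m n × WithLp 1 (ℝ × ℝ))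

/-- `L^∞([0, T]; ℝ^{m × n} × ℝ × ℝ)`. -/
abbrev Control (m n : ℕ) (T : ℝ) : Type :=
  Lp (Param m n) ∞ (volume.restrict (Set.Icc (0 : ℝ) T))

namespace Control

variable {m n : ℕ} {T : ℝ}

/-- The matrix component. -/
def A (u : Control m n T) : ℝ → Mat m n := fun t => (u t).fst

/-- The step size component. -/
def α (u : Control m n T) : ℝ → ℝ := fun t => (u t).snd.fst

/-- The trade-off component. -/
def lam (u : Control m n T) : ℝ → ℝ := fun t => (u t).snd.snd

end Control

end FBS

end

/-! With `h = T / N`, a layer is one explicit-implicit Euler step for the inclusion: an explicit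
gradient step for the least-squares term, then a proximal step for `R`. Averaging keeps the bound
`B` and the signs of the parameters. A discrete Gronwall argument therefore bounds all states
uniformly in `N`, and (A3) then bounds the subgradients and the velocities. Consequently the
piecewise linear interpolation of a network state solves the inclusion with averaged parameters, up
to evaluating gradient and subgradient at points `O(1/N)` away (`IsNetworkState.isApproxState`).

The central estimate is `norm_sub_sq_le`. In the derivative of `‖x₁ - x₂‖²`, monotonicity of `AᵀA`
and of `∂R` gives the main terms a favourable sign, and the remainder is linear in the evaluation
errors and in the pointwise distance of the parameters. Integration bounds `‖x₁ - x₂‖²` on `[0, T]`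
by a constant times the errors plus the `L¹` distance of the parameters. This yields uniqueness (no
errors, equal parameters), the Cauchy property of the interpolations, and the convergence of the
terminal states.

For existence, the Cauchy property produces a uniform limit but says nothing about derivatives. The
inclusion is therefore recast as an integrated evolution variational inequality, which involves
neither derivatives nor subgradients. It passes to the limit by dominated convergence
(`norm_sq_sub_le_of_tendsto`), and differentiating it at almost every time recovers the inclusion
(`isLimitState_of_norm_sq_sub_le`).

The averaged parameters converge in `L¹` because averaging is an `L¹` contraction and the averages
of a fixed function converge almost everywhere by Lebesgue differentiation. The regularizers
converge because the discrete means are integrals of step functions and `r ↦ r ^ p` is Lipschitz on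
`[0, B]`. -/

noncomputable section

namespace FBS

/-! ### The least-squares gradient: growth, Lipschitz bounds, monotonicity. -/

section GradTerm

variable {m n : ℕ}

theorem norm_toEuclideanLin_le (A : Mat m n) (x : Vec n) :
    ‖Matrix.toEuclideanLin A x‖ ≤ ‖A‖ * ‖x‖ :=
  Matrix.l2_opNorm_mulVec A x

theorem norm_transpose_eq (A : Mat m n) : ‖A.transpose‖ = ‖A‖ := by
  rw [← Matrix.conjTranspose_eq_transpose_of_trivial, Matrix.l2_opNorm_conjTranspose]

theorem inner_toEuclideanLin_transpose (A : Mat m n) (y : Vec m) (x : Vec n) :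
    ⟪Matrix.toEuclideanLin A.transpose y, x⟫ = ⟪y, Matrix.toEuclideanLin A x⟫ := by
  rw [← Matrix.conjTranspose_eq_transpose_of_trivial, Matrix.toEuclideanLin_conjTranspose_eq_adjoint,
    LinearMap.adjoint_inner_left]

theorem norm_gradTerm_le (A : Mat m n) (b : Vec m) (x : Vec n) :
    ‖gradTerm A b x‖ ≤ ‖A‖ * (‖A‖ * ‖x‖ + ‖b‖) := by
  unfold gradTerm
  refine (norm_toEuclideanLin_le _ _).trans ?_
  rw [norm_transpose_eq]
  gcongr
  exact (norm_sub_le _ _).trans (by gcongr; exact norm_toEuclideanLin_le _ _)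

/-- The vector `b` cancels, leaving the positive semidefinite `AᵀA`; both the Lipschitz bound and
the monotonicity come from this. -/
theorem gradTerm_sub_gradTerm (A : Mat m n) (b : Vec m) (x y : Vec n) :
    gradTerm A b x - gradTerm A b y
      = Matrix.toEuclideanLin A.transpose (Matrix.toEuclideanLin A (x - y)) := by
  unfold gradTerm
  rw [← map_sub, map_sub (Matrix.toEuclideanLin A) x y]
  congr 1
  abel

theorem norm_gradTerm_sub_le (A : Mat m n) (b : Vec m) (x y : Vec n) :
    ‖gradTerm A b x - gradTerm A b y‖ ≤ ‖A‖ * (‖A‖ * ‖x - y‖) := by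
  rw [gradTerm_sub_gradTerm]
  refine (norm_toEuclideanLin_le _ _).trans ?_
  rw [norm_transpose_eq]
  gcongr
  exact norm_toEuclideanLin_le _ _

theorem inner_gradTerm_sub_nonneg (A : Mat m n) (b : Vec m) (x y : Vec n) :
    0 ≤ ⟪gradTerm A b x - gradTerm A b y, x - y⟫ := by
  rw [gradTerm_sub_gradTerm, inner_toEuclideanLin_transpose]
  exact real_inner_self_nonneg

theorem norm_gradTerm_sub_left_le (A A' : Mat m n) (b : Vec m) (x : Vec n) :
    ‖gradTerm A b x - gradTerm A' b x‖
      ≤ ‖A - A'‖ * (‖A‖ * ‖x‖ + ‖b‖ + ‖A'‖ * ‖x‖) := by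
  have h : gradTerm A b x - gradTerm A' b x
      = Matrix.toEuclideanLin (A - A').transpose (Matrix.toEuclideanLin A x - b)
        + Matrix.toEuclideanLin A'.transpose (Matrix.toEuclideanLin (A - A') x) := by
    unfold gradTerm
    simp only [Matrix.transpose_sub, map_sub, LinearMap.sub_apply]
    abel
  rw [h]
  have h1 := norm_toEuclideanLin_le (A - A').transpose (Matrix.toEuclideanLin A x - b)
  have h2 := norm_toEuclideanLin_le A'.transpose (Matrix.toEuclideanLin (A - A') x)
  have h3 := norm_toEuclideanLin_le (A - A') x
  have h4 := norm_toEuclideanLin_le A x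
  have h5 := norm_sub_le (Matrix.toEuclideanLin A x) b
  rw [norm_transpose_eq] at h1 h2
  have h6 : ‖A - A'‖ * ‖Matrix.toEuclideanLin A x - b‖ ≤ ‖A - A'‖ * (‖A‖ * ‖x‖ + ‖b‖) := by
    gcongr; linarith
  have h7 : ‖A'‖ * ‖Matrix.toEuclideanLin (A - A') x‖ ≤ ‖A'‖ * (‖A - A'‖ * ‖x‖) := by
    gcongr
  have h8 := norm_add_le (Matrix.toEuclideanLin (A - A').transpose (Matrix.toEuclideanLin A x - b))
    (Matrix.toEuclideanLin A'.transpose (Matrix.toEuclideanLin (A - A') x))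
  nlinarith

theorem continuous_gradTerm (b : Vec m) :
    Continuous fun q : Mat m n × Vec n => gradTerm q.1 b q.2 := by
  have h (k l : ℕ) : Continuous fun q : Mat k l × Vec l => Matrix.toEuclideanLin q.1 q.2 :=
    (PiLp.continuous_toLp 2 _).comp
      (Continuous.matrix_mulVec continuous_fst ((PiLp.continuous_ofLp 2 _).comp continuous_snd))
  exact (h n m).comp (continuous_fst.matrix_transpose.prodMk ((h m n).sub continuous_const))

end GradTerm

/-! ### Subgradients and the proximal step. -/

section Subdiff

variable {n : ℕ} {R : Vec n → ℝ}

theorem subdiff_monotone {x y z w : Vec n} (hz : z ∈ subdiff R x) (hw : w ∈ subdiff R y) :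
    0 ≤ ⟪z - w, x - y⟫ := by
  have h1 := hz y
  have h2 := hw x
  simp only [inner_sub_left, inner_sub_right] at *
  linarith

/-- The optimality condition for the proximal mapping. -/
theorem exists_prox_of_pos (hR : ConvexOn ℝ Set.univ R) (h0 : (0 : Vec n) ∈ subdiff R 0)
    {c : ℝ} (hc : 0 < c) (y : Vec n) : ∃ x, c⁻¹ • (y - x) ∈ subdiff R x := by
  have hcont : Continuous R := hR.locallyLipschitz.continuous
  have hlow (w : Vec n) : R 0 ≤ R w := by simpa using h0 w
  have hf : Continuous fun w => R w + (2 * c)⁻¹ * ‖w - y‖ ^ 2 := by fun_prop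
  -- The prox is a minimiser of `R + (2c)⁻¹ ‖· - y‖²`. By (A2) `R` is bounded below by `R 0`, so the
  -- quadratic makes this function coercive.
  obtain ⟨x, hx⟩ := hf.exists_forall_le (by
    have h1 : Tendsto (fun w : Vec n => ‖w - y‖) (cocompact _) atTop := by
      have := tendsto_norm_cocompact_atTop (E := Vec n)
      refine tendsto_atTop_mono (fun w => ?_) (tendsto_atTop_add_const_right _ (-‖y‖) this)
      have := norm_sub_norm_le w y
      linarith
    have h2 : Tendsto (fun w : Vec n => R 0 + (2 * c)⁻¹ * ‖w - y‖ ^ 2) (cocompact _) atTop :=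
      tendsto_atTop_add_const_left _ _
        (((tendsto_pow_atTop two_ne_zero).comp h1).const_mul_atTop (by positivity))
    exact tendsto_atTop_mono (fun w => by linarith [hlow w]) h2)
  refine ⟨x, fun w => ?_⟩
  -- Minimality is tested at `x + t (w - x)`; convexity bounds `R` there, and division by `t` leaves
  -- an error of order `t` that vanishes as `t → 0`.
  have key (t : ℝ) (ht : t ∈ Set.Ioc (0 : ℝ) 1) :
      R x + ⟪c⁻¹ • (y - x), w - x⟫ ≤ R w + t * ((2 * c)⁻¹ * ‖w - x‖ ^ 2) := by
    have h1 := hx (x + t • (w - x))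
    have h2 := hR.2 (Set.mem_univ x) (Set.mem_univ w) (sub_nonneg.2 ht.2) ht.1.le (by ring)
    have h3 : (1 - t) • x + t • w = x + t • (w - x) := by module
    rw [h3, smul_eq_mul, smul_eq_mul] at h2
    have h4 : ‖x + t • (w - x) - y‖ ^ 2
        = ‖x - y‖ ^ 2 + 2 * t * ⟪x - y, w - x⟫ + t ^ 2 * ‖w - x‖ ^ 2 := by
      rw [show x + t • (w - x) - y = (x - y) + t • (w - x) by abel, norm_add_sq_real,
        inner_smul_right, norm_smul, mul_pow, Real.norm_eq_abs, sq_abs]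
      ring
    rw [h4] at h1
    have h5 : ⟪c⁻¹ • (y - x), w - x⟫ = - (c⁻¹ * ⟪x - y, w - x⟫) := by
      rw [inner_smul_left, ← neg_sub x y, inner_neg_left]; simp
    rw [h5]
    have h6 : (2 * c)⁻¹ = c⁻¹ / 2 := by field_simp
    rw [h6] at h1 ⊢
    have h7 : 0 ≤ t * (R w + t * (c⁻¹ / 2 * ‖w - x‖ ^ 2) + c⁻¹ * ⟪x - y, w - x⟫ - R x) := by
      nlinarith
    have := nonneg_of_mul_nonneg_right h7 ht.1
    linarith
  have hlim : Tendsto (fun t : ℝ => R w + t * ((2 * c)⁻¹ * ‖w - x‖ ^ 2)) (𝓝[>] 0)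
      (𝓝 (R w + 0 * ((2 * c)⁻¹ * ‖w - x‖ ^ 2))) := by
    apply Tendsto.mono_left _ nhdsWithin_le_nhds
    exact Continuous.tendsto (by fun_prop) 0
  rw [zero_mul, add_zero] at hlim
  exact ge_of_tendsto hlim (eventually_of_mem (Ioc_mem_nhdsGT one_pos) key)

/-- A fixed bound on the subgradients at the points of norm at most `ρ`. -/
def SubdiffBound (R : Vec n → ℝ) (ρ G : ℝ) : Prop :=
  ∀ x : Vec n, ‖x‖ ≤ ρ → ∀ z ∈ subdiff R x, ‖z‖ ≤ G

theorem exists_subdiffBound (h : ∃ M : ℝ, 0 < M ∧ ∀ x : Vec n,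
      (∀ z ∈ subdiff R x, ‖z‖ ≤ M * ‖x‖) ∨ (∀ z ∈ subdiff R x, ‖z‖ ≤ M)) (ρ : ℝ) :
    ∃ G, 0 ≤ G ∧ SubdiffBound R ρ G := by
  obtain ⟨M, hM, h⟩ := h
  refine ⟨max (M * ρ) M, le_max_of_le_right hM.le, fun x hx z hz => ?_⟩
  rcases h x with h | h
  · exact (h z hz).trans (le_max_of_le_left (by gcongr))
  · exact (h z hz).trans (le_max_right _ _)

/-- The prox is nonexpansive and, by (A2), fixes `0`. Concretely, pairing `y = x + c z` with `x` and
using `⟪z, x⟫ ≥ 0` gives the bound. -/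
theorem norm_le_of_prox (h0 : (0 : Vec n) ∈ subdiff R 0) {c : ℝ} (hc : 0 ≤ c) {x y z : Vec n}
    (hz : z ∈ subdiff R x) (h : x - y + c • z = 0) : ‖x‖ ≤ ‖y‖ := by
  have h1 := subdiff_monotone hz h0
  rw [sub_zero, sub_zero] at h1
  have h2 : y = x + c • z := by rw [← sub_eq_zero, ← neg_eq_zero, ← h]; abel
  have h3 : ‖x‖ * ‖x‖ ≤ ‖y‖ * ‖x‖ := by
    calc ‖x‖ * ‖x‖ = ⟪x, x⟫ := (real_inner_self_eq_norm_mul_norm x).symm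
      _ ≤ ⟪y, x⟫ := by
        rw [h2, inner_add_left, inner_smul_left]
        have := mul_nonneg hc h1
        simpa using this
      _ ≤ ‖y‖ * ‖x‖ := real_inner_le_norm _ _
  by_contra! hlt
  nlinarith [norm_nonneg y]

theorem prox_unique {c : ℝ} (hc : 0 ≤ c) {x x' y z z' : Vec n}
    (hz : z ∈ subdiff R x) (hz' : z' ∈ subdiff R x')
    (h : x - y + c • z = 0) (h' : x' - y + c • z' = 0) : x = x' := by
  have h1 := subdiff_monotone hz hz'
  have h2 : x - x' = -(c • (z - z')) := by
    rw [← sub_eq_zero, ← sub_eq_zero.2 (h.trans h'.symm)]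
    module
  have h3 : ⟪x - x', x - x'⟫ ≤ 0 := by
    nth_rw 1 [h2]
    rw [inner_neg_left, inner_smul_left]
    have := mul_nonneg hc h1
    simpa using this
  exact sub_eq_zero.1 (inner_self_eq_zero.1 (le_antisymm h3 real_inner_self_nonneg))

theorem mem_subdiff_of_tendsto (hR : Continuous R) {x z : ℕ → Vec n} {x₀ z₀ : Vec n}
    (hx : Tendsto x atTop (𝓝 x₀)) (hz : Tendsto z atTop (𝓝 z₀))
    (h : ∀ k, z k ∈ subdiff R (x k)) : z₀ ∈ subdiff R x₀ := fun w =>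
  le_of_tendsto (((hR.tendsto x₀).comp hx).add (hz.inner (tendsto_const_nhds.sub hx)))
    (Eventually.of_forall fun k => h k w)

/-- A subgradient at `y` is a limit point of the Yosida quotients `(y - x k) / c k`, where `x k` is
the prox with parameter `c k = 1 / (k + 1)`. Since `‖x k‖ ≤ ‖y‖`, the quotients are bounded by `G`;
hence `x k → y`, and the graph of `∂R` is closed. Nonemptiness matters where `α lam = 0`: the
inclusion still asks for some subgradient there. -/
theorem subdiff_nonempty (hR : ConvexOn ℝ Set.univ R) (h0 : (0 : Vec n) ∈ subdiff R 0)
    (hb : ∀ ρ, ∃ G, 0 ≤ G ∧ SubdiffBound R ρ G) (y : Vec n) : (subdiff R y).Nonempty := by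
  obtain ⟨G, hG0, hG⟩ := hb ‖y‖
  have hc (k : ℕ) : (0 : ℝ) < 1 / ((k : ℝ) + 1) := by positivity
  choose x hx using fun k : ℕ => exists_prox_of_pos hR h0 (hc k) y
  set z : ℕ → Vec n := fun k => (1 / ((k : ℝ) + 1))⁻¹ • (y - x k) with hzdef
  have heq (k : ℕ) : x k - y + (1 / ((k : ℝ) + 1)) • z k = 0 := by
    rw [hzdef]
    simp only
    rw [smul_inv_smul₀ (hc k).ne']
    abel
  have hxb (k : ℕ) : ‖x k‖ ≤ ‖y‖ := norm_le_of_prox h0 (hc k).le (hx k) (heq k)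
  have hzb (k : ℕ) : ‖z k‖ ≤ G := hG _ (hxb k) _ (hx k)
  have hlim : Tendsto x atTop (𝓝 y) := by
    rw [tendsto_iff_norm_sub_tendsto_zero]
    have h1 : Tendsto (fun k : ℕ => 1 / ((k : ℝ) + 1) * G) atTop (𝓝 (0 * G)) :=
      tendsto_one_div_add_atTop_nhds_zero_nat.mul_const G
    rw [zero_mul] at h1
    refine squeeze_zero (fun _ => norm_nonneg _) (fun k => ?_) h1
    have : x k - y = -((1 / ((k : ℝ) + 1)) • z k) := by
      rw [← sub_eq_zero, ← heq k]; abel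
    rw [this, norm_neg, norm_smul, Real.norm_of_nonneg (hc k).le]
    exact mul_le_mul_of_nonneg_left (hzb k) (hc k).le
  obtain ⟨z₀, -, φ, hφ, hz₀⟩ := tendsto_subseq_of_bounded
    (Metric.isBounded_closedBall (x := (0 : Vec n)) (r := G)) (x := z) (fun k => by simpa using hzb k)
  exact ⟨z₀, mem_subdiff_of_tendsto hR.locallyLipschitz.continuous
    (hlim.comp hφ.tendsto_atTop) hz₀ fun k => hx (φ k)⟩

theorem exists_prox (hR : ConvexOn ℝ Set.univ R) (h0 : (0 : Vec n) ∈ subdiff R 0)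
    (hb : ∀ ρ, ∃ G, 0 ≤ G ∧ SubdiffBound R ρ G) {c : ℝ} (hc : 0 ≤ c) (y : Vec n) :
    ∃ x, ∃ z ∈ subdiff R x, x - y + c • z = 0 := by
  rcases hc.eq_or_lt with rfl | hc
  · obtain ⟨z, hz⟩ := subdiff_nonempty hR h0 hb y
    exact ⟨y, z, hz, by simp⟩
  · obtain ⟨x, hx⟩ := exists_prox_of_pos hR h0 hc y
    refine ⟨x, _, hx, ?_⟩
    rw [smul_inv_smul₀ hc.ne']
    abel

end Subdiff

/-! ### Unique solvability of the network and uniform bounds on its states. -/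

section Network

variable {m n : ℕ} {R : Vec n → ℝ} {T : ℝ} {b : Vec m} {x0 : Vec n} {N : ℕ}
  {A : Fin N → Mat m n} {α lam : Fin N → ℝ}

theorem existsUnique_isNetworkState (hR : ConvexOn ℝ Set.univ R) (h0 : (0 : Vec n) ∈ subdiff R 0)
    (hb : ∀ ρ, ∃ G, 0 ≤ G ∧ SubdiffBound R ρ G) (hT : 0 ≤ T)
    (hα : ∀ k, 0 ≤ α k) (hlam : ∀ k, 0 ≤ lam k) :
    ∃! x : Fin (N + 1) → Vec n, IsNetworkState R T b x0 A α lam x := by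
  have hc (k : Fin N) : 0 ≤ T / N * α k * lam k := by
    have := hα k; have := hlam k; positivity
  -- `f k` is the layer map: the prox of the explicit gradient step.
  choose f z hz hf using fun (k : Fin N) (y : Vec n) =>
    exists_prox hR h0 hb (hc k) (y - (T / N * α k) • gradTerm (A k) b y)
  refine ⟨fun i => Fin.induction x0 (fun k y => f k y) i, ⟨rfl, fun k => ?_⟩, fun x hx => ?_⟩
  · refine ⟨_, hz k _, ?_⟩
    rw [← hf k _]
    simp only [Fin.induction_succ]
    abel
  · funext i
    induction i using Fin.induction with
    | zero => exact hx.1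
    | succ k ih =>
      obtain ⟨w, hw, h⟩ := hx.2 k
      rw [ih] at h
      simp only [Fin.induction_succ]
      refine prox_unique (hc k) hw (hz k _) ?_ (hf k _)
      rw [← h]
      abel

/-- The a priori bound on the states of networks with parameters of norm at most `B`. -/
def stateBound (T B β r : ℝ) : ℝ := Real.exp (T * B ^ 3) * (r + T * (B ^ 2 * β))

/-- The a priori bound on the velocity of states of norm at most `ρ`. -/
def speedBound (B β ρ G : ℝ) : ℝ := B * (B * (B * ρ + β)) + B * B * G

theorem norm_velocity_le {B ρ G a l : ℝ} {A : Mat m n} {y z : Vec n}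
    (hA : ‖A‖ ≤ B) (ha : 0 ≤ a) (haB : a ≤ B) (hl : 0 ≤ l) (hlB : l ≤ B) (hy : ‖y‖ ≤ ρ)
    (hz : ‖z‖ ≤ G) :
    ‖a • gradTerm A b y + (a * l) • z‖ ≤ speedBound B ‖b‖ ρ G := by
  have hB : 0 ≤ B := ha.trans haB
  have hρ : 0 ≤ ρ := (norm_nonneg _).trans hy
  refine (norm_add_le _ _).trans ?_
  rw [norm_smul, norm_smul, Real.norm_of_nonneg ha, Real.norm_of_nonneg (mul_nonneg ha hl)]
  unfold speedBound
  gcongr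
  exact (norm_gradTerm_le A b y).trans (by gcongr)

/-- Discrete Gronwall: the prox does not increase the norm, so one layer multiplies it by at most `1
+ h B³ ≤ exp (h B³)` and adds at most `h B² ‖b‖`. The bound does not depend on `N`. -/
theorem IsNetworkState.norm_le {B : ℝ} (hB : 0 ≤ B) (h0 : (0 : Vec n) ∈ subdiff R 0) (hT : 0 ≤ T)
    (hA : ∀ k, ‖A k‖ ≤ B) (hα : ∀ k, 0 ≤ α k ∧ α k ≤ B) (hlam : ∀ k, 0 ≤ lam k ∧ lam k ≤ B)
    {x : Fin (N + 1) → Vec n} (hx : IsNetworkState R T b x0 A α lam x) (i : Fin (N + 1)) :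
    ‖x i‖ ≤ stateBound T B ‖b‖ ‖x0‖ := by
  set h : ℝ := T / N with hh
  have hh0 : 0 ≤ h := by positivity
  have key : ‖x i‖ ≤ Real.exp ((i : ℕ) * h * B ^ 3) * (‖x0‖ + (i : ℕ) * h * (B ^ 2 * ‖b‖)) := by
    induction i using Fin.induction with
    | zero => simp [hx.1]
    | succ k ih =>
      obtain ⟨w, hw, e⟩ := hx.2 k
      have hk := hα k
      have hl := hlam k
      have h1 : ‖x k.succ‖ ≤ ‖x k.castSucc - (h * α k) • gradTerm (A k) b (x k.castSucc)‖ := by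
        refine norm_le_of_prox h0 (c := h * α k * lam k)
          (mul_nonneg (mul_nonneg hh0 hk.1) hl.1) hw ?_
        rw [← e]
        abel
      have h2 : ‖x k.succ‖ ≤ (h * B ^ 3 + 1) * ‖x k.castSucc‖ + h * (B ^ 2 * ‖b‖) := by
        refine h1.trans ((norm_sub_le _ _).trans ?_)
        rw [norm_smul, Real.norm_of_nonneg (mul_nonneg hh0 hk.1)]
        have h3 : h * α k * ‖gradTerm (A k) b (x k.castSucc)‖
            ≤ h * B * (B * (B * ‖x k.castSucc‖ + ‖b‖)) := by
          have := hA k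
          refine mul_le_mul (mul_le_mul_of_nonneg_left hk.2 hh0)
            ((norm_gradTerm_le _ _ _).trans ?_) (norm_nonneg _) (by positivity)
          gcongr
        nlinarith
      have h4 : h * B ^ 3 + 1 ≤ Real.exp (h * B ^ 3) := Real.add_one_le_exp _
      have h5 : (1 : ℝ) ≤ Real.exp (((k.succ : Fin (N + 1)) : ℕ) * h * B ^ 3) :=
        Real.one_le_exp (by positivity)
      have h6 : Real.exp (((k.succ : Fin (N + 1)) : ℕ) * h * B ^ 3)
          = Real.exp (h * B ^ 3) * Real.exp (((k.castSucc : Fin (N + 1)) : ℕ) * h * B ^ 3) := by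
        rw [← Real.exp_add]
        congr 1
        simp
        ring
      calc ‖x k.succ‖ ≤ (h * B ^ 3 + 1) * ‖x k.castSucc‖ + h * (B ^ 2 * ‖b‖) := h2
        _ ≤ Real.exp (h * B ^ 3) * (Real.exp (((k.castSucc : Fin (N + 1)) : ℕ) * h * B ^ 3)
              * (‖x0‖ + ((k.castSucc : Fin (N + 1)) : ℕ) * h * (B ^ 2 * ‖b‖)))
              + Real.exp (((k.succ : Fin (N + 1)) : ℕ) * h * B ^ 3) * (h * (B ^ 2 * ‖b‖)) := by
          refine add_le_add (mul_le_mul h4 ih (norm_nonneg _) (Real.exp_nonneg _)) ?_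
          exact le_mul_of_one_le_left (by positivity) h5
        _ = _ := by
          rw [h6]
          simp
          ring
  refine key.trans ?_
  have hi : ((i : ℕ) : ℝ) * h ≤ T := by
    -- For `N = 0`, division by zero makes `h = 0`.
    rcases Nat.eq_zero_or_pos N with rfl | hN
    · simp [hh, hT]
    · have h1 : ((i : ℕ) : ℝ) ≤ N := by exact_mod_cast Nat.lt_succ_iff.1 i.2
      calc ((i : ℕ) : ℝ) * h ≤ N * h := by gcongr
        _ = T := by rw [hh]; field_simp
  unfold stateBound
  gcongr

theorem IsNetworkState.norm_succ_sub_le {B ρ G : ℝ} (hT : 0 ≤ T)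
    (hA : ∀ k, ‖A k‖ ≤ B) (hα : ∀ k, 0 ≤ α k ∧ α k ≤ B) (hlam : ∀ k, 0 ≤ lam k ∧ lam k ≤ B)
    {x : Fin (N + 1) → Vec n} (hx : IsNetworkState R T b x0 A α lam x) (hρ : ∀ i, ‖x i‖ ≤ ρ)
    (hG : SubdiffBound R ρ G) (k : Fin N) :
    ‖x k.succ - x k.castSucc‖ ≤ T / N * speedBound B ‖b‖ ρ G := by
  obtain ⟨w, hw, e⟩ := hx.2 k
  have h1 : x k.succ - x k.castSucc
      = -((T / N) • (α k • gradTerm (A k) b (x k.castSucc) + (α k * lam k) • w)) := by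
    rw [← sub_eq_zero, ← e]
    module
  rw [h1, norm_neg, norm_smul, Real.norm_of_nonneg (by positivity)]
  refine mul_le_mul_of_nonneg_left ?_ (by positivity)
  exact norm_velocity_le (hA k) (hα k).1 (hα k).2 (hlam k).1 (hlam k).2 (hρ _) (hG _ (hρ _) _ hw)

end Network

/-! ### Stability of approximate solutions in the `L¹` distance of the parameters. -/

section Comparison

variable {m n : ℕ} {R : Vec n → ℝ} {T : ℝ} {b : Vec m}

/-- Integrable parameters on `[0, T]` that are bounded by `B`, with nonnegative scalars. -/
structure IsParam (T B : ℝ) (A : ℝ → Mat m n) (α lam : ℝ → ℝ) : Prop where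
  integrable_A : IntegrableOn A (Set.Icc 0 T)
  integrable_α : IntegrableOn α (Set.Icc 0 T)
  integrable_lam : IntegrableOn lam (Set.Icc 0 T)
  bound : ∀ᵐ t ∂(volume.restrict (Set.Icc 0 T)),
    ‖A t‖ ≤ B ∧ (0 ≤ α t ∧ α t ≤ B) ∧ 0 ≤ lam t ∧ lam t ≤ B

/-- The pointwise distance of two parameter functions. -/
def paramDist (A A' : ℝ → Mat m n) (α α' lam lam' : ℝ → ℝ) (t : ℝ) : ℝ :=
  ‖A t - A' t‖ + |α t - α' t| + |lam t - lam' t|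

theorem IsParam.integrableOn_paramDist {B B' : ℝ} {A A' : ℝ → Mat m n} {α α' lam lam' : ℝ → ℝ}
    (h : IsParam T B A α lam) (h' : IsParam T B' A' α' lam') :
    IntegrableOn (paramDist A A' α α' lam lam') (Set.Icc 0 T) :=
  ((h.integrable_A.sub h'.integrable_A).norm.add (h.integrable_α.sub h'.integrable_α).norm).add
    (h.integrable_lam.sub h'.integrable_lam).norm

theorem paramDist_nonneg (A A' : ℝ → Mat m n) (α α' lam lam' : ℝ → ℝ) (t : ℝ) :
    0 ≤ paramDist A A' α α' lam lam' t := by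
  unfold paramDist
  positivity

/-- A solution of the differential inclusion up to errors of size `ε` in the arguments of the
right-hand side. -/
structure IsApproxState (R : Vec n → ℝ) (T : ℝ) (b : Vec m) (ε ρ : ℝ)
    (A : ℝ → Mat m n) (α lam : ℝ → ℝ) (x : ℝ → Vec n) : Prop where
  absCont : AbsolutelyContinuousOnInterval x 0 T
  ae_inclusion : ∀ᵐ t ∂(volume.restrict (Set.Icc 0 T)), ∃ v y y' z : Vec n, HasDerivAt x v t ∧
    z ∈ subdiff R y' ∧ ‖y - x t‖ ≤ ε ∧ ‖y' - x t‖ ≤ ε ∧ ‖x t‖ ≤ ρ ∧ ‖y'‖ ≤ ρ ∧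
    v + α t • gradTerm (A t) b y + (α t * lam t) • z = 0

/-- The constant in the comparison of approximate solutions. -/
def compareConst (B β ρ G : ℝ) : ℝ :=
  2 * (2 * ρ * (B ^ 3 + B * (B * ρ + β) + B * (2 * B * ρ + β) + 2 * B * G) + 2 * G * B ^ 2)

theorem compareConst_nonneg {B β ρ G : ℝ} (hB : 0 ≤ B) (hβ : 0 ≤ β) (hρ : 0 ≤ ρ) (hG : 0 ≤ G) :
    0 ≤ compareConst B β ρ G := by
  unfold compareConst
  positivity

theorem neg_le_inner_of_norm_le {E : Type*} [NormedAddCommGroup E] [InnerProductSpace ℝ E]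
    {u w : E} {c d : ℝ} (hu : ‖u‖ ≤ c) (hw : ‖w‖ ≤ d) : -(d * c) ≤ ⟪u, w⟫ := by
  have h1 := neg_le_of_abs_le (abs_real_inner_le_norm u w)
  have h2 : ‖u‖ * ‖w‖ ≤ c * d :=
    mul_le_mul hu hw (norm_nonneg _) ((norm_nonneg _).trans hu)
  linarith

/-- The points `y` and `y'` are where gradient and subgradient are evaluated; for a network they are
the left and right nodes of a cell. Monotonicity controls the two terms that are not small. In all
others `‖x₁ - x₂‖` is replaced by `2 ρ`, so the bound is linear in the errors and no Gronwall
argument is needed afterwards. -/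
theorem inner_velocity_le {B ρ G ε₁ ε₂ a₁ a₂ l₁ l₂ : ℝ} {A₁ A₂ : Mat m n}
    {x₁ x₂ y₁ y₂ y₁' y₂' z₁ z₂ v₁ v₂ : Vec n}
    (hA₁ : ‖A₁‖ ≤ B) (hA₂ : ‖A₂‖ ≤ B) (ha₁ : 0 ≤ a₁ ∧ a₁ ≤ B) (ha₂ : 0 ≤ a₂ ∧ a₂ ≤ B)
    (hl₁ : 0 ≤ l₁ ∧ l₁ ≤ B) (hl₂ : 0 ≤ l₂ ∧ l₂ ≤ B) (hG : SubdiffBound R ρ G)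
    (hz₁ : z₁ ∈ subdiff R y₁') (hz₂ : z₂ ∈ subdiff R y₂')
    (hy₁ : ‖y₁ - x₁‖ ≤ ε₁) (hy₂ : ‖y₂ - x₂‖ ≤ ε₂)
    (hy₁' : ‖y₁' - x₁‖ ≤ ε₁) (hy₂' : ‖y₂' - x₂‖ ≤ ε₂)
    (hx₁ρ : ‖x₁‖ ≤ ρ) (hx₂ρ : ‖x₂‖ ≤ ρ) (hy₁ρ : ‖y₁'‖ ≤ ρ) (hy₂ρ : ‖y₂'‖ ≤ ρ)
    (e₁ : v₁ + a₁ • gradTerm A₁ b y₁ + (a₁ * l₁) • z₁ = 0)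
    (e₂ : v₂ + a₂ • gradTerm A₂ b y₂ + (a₂ * l₂) • z₂ = 0) :
    2 * ⟪x₁ - x₂, v₁ - v₂⟫
      ≤ compareConst B ‖b‖ ρ G * (ε₁ + ε₂ + (‖A₁ - A₂‖ + |a₁ - a₂| + |l₁ - l₂|)) := by
  have hB : 0 ≤ B := ha₁.1.trans ha₁.2
  have hρ : 0 ≤ ρ := (norm_nonneg _).trans hx₁ρ
  have hε₁ : 0 ≤ ε₁ := (norm_nonneg _).trans hy₁
  have hε₂ : 0 ≤ ε₂ := (norm_nonneg _).trans hy₂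
  have hz₁G := hG _ hy₁ρ _ hz₁
  have hz₂G := hG _ hy₂ρ _ hz₂
  have hG0 : 0 ≤ G := (norm_nonneg _).trans hz₁G
  set D := x₁ - x₂ with hD
  have hDρ : ‖D‖ ≤ 2 * ρ := (norm_sub_le _ _).trans (by linarith)
  -- Telescoping of the velocity difference, changing one argument at a time. The terms `p₂` and
  -- `p₆` are monotone; the other five are bounded in norm.
  set p₁ := a₁ • (gradTerm A₁ b y₁ - gradTerm A₁ b x₁) with hp₁
  set p₂ := gradTerm A₁ b x₁ - gradTerm A₁ b x₂ with hp₂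
  set p₃ := (a₁ - a₂) • gradTerm A₁ b x₂ with hp₃
  set p₄ := a₂ • (gradTerm A₁ b x₂ - gradTerm A₂ b x₂) with hp₄
  set p₅ := a₂ • (gradTerm A₂ b x₂ - gradTerm A₂ b y₂) with hp₅
  set p₆ := z₁ - z₂ with hp₆
  set p₇ := (a₁ * l₁ - a₂ * l₂) • z₂ with hp₇
  have hsum : v₁ - v₂ = -(p₁ + a₁ • p₂ + p₃ + p₄ + p₅ + (a₁ * l₁) • p₆ + p₇) := by
    rw [← sub_eq_zero, ← sub_eq_zero.2 (e₁.trans e₂.symm), hp₁, hp₂, hp₃, hp₄, hp₅, hp₆, hp₇]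
    module
  have n₁ : ‖p₁‖ ≤ B ^ 3 * ε₁ := by
    rw [hp₁, norm_smul, Real.norm_of_nonneg ha₁.1]
    calc a₁ * ‖gradTerm A₁ b y₁ - gradTerm A₁ b x₁‖ ≤ B * (B * (B * ε₁)) := by
          refine mul_le_mul ha₁.2 ((norm_gradTerm_sub_le _ _ _ _).trans ?_) (norm_nonneg _) hB
          gcongr
      _ = _ := by ring
  have n₃ : ‖p₃‖ ≤ B * (B * ρ + ‖b‖) * |a₁ - a₂| := by
    rw [hp₃, norm_smul, Real.norm_eq_abs, mul_comm]
    refine mul_le_mul_of_nonneg_right ((norm_gradTerm_le _ _ _).trans ?_) (abs_nonneg _)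
    gcongr
  have n₄ : ‖p₄‖ ≤ B * (2 * B * ρ + ‖b‖) * ‖A₁ - A₂‖ := by
    rw [hp₄, norm_smul, Real.norm_of_nonneg ha₂.1]
    calc a₂ * ‖gradTerm A₁ b x₂ - gradTerm A₂ b x₂‖
        ≤ B * (‖A₁ - A₂‖ * (B * ρ + ‖b‖ + B * ρ)) := by
          refine mul_le_mul ha₂.2 ((norm_gradTerm_sub_left_le _ _ _ _).trans ?_) (norm_nonneg _) hB
          gcongr
      _ = _ := by ring
  have n₅ : ‖p₅‖ ≤ B ^ 3 * ε₂ := by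
    rw [hp₅, norm_smul, Real.norm_of_nonneg ha₂.1]
    calc a₂ * ‖gradTerm A₂ b x₂ - gradTerm A₂ b y₂‖ ≤ B * (B * (B * ε₂)) := by
          refine mul_le_mul ha₂.2 ((norm_gradTerm_sub_le _ _ _ _).trans ?_) (norm_nonneg _) hB
          rw [norm_sub_rev]
          gcongr
      _ = _ := by ring
  have n₇ : ‖p₇‖ ≤ (B * |l₁ - l₂| + B * |a₁ - a₂|) * G := by
    rw [hp₇, norm_smul, Real.norm_eq_abs]
    refine mul_le_mul ?_ hz₂G (norm_nonneg _) (by positivity)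
    calc |a₁ * l₁ - a₂ * l₂| = |a₁ * (l₁ - l₂) + l₂ * (a₁ - a₂)| := by ring_nf
      _ ≤ a₁ * |l₁ - l₂| + l₂ * |a₁ - a₂| := by
        refine (abs_add_le _ _).trans ?_
        rw [abs_mul, abs_mul, abs_of_nonneg ha₁.1, abs_of_nonneg hl₂.1]
      _ ≤ _ := by gcongr <;> tauto
  have i₂ : 0 ≤ a₁ * ⟪p₂, D⟫ := mul_nonneg ha₁.1 (inner_gradTerm_sub_nonneg _ _ _ _)
  -- The subgradients are monotone along `y₁' - y₂'` rather than along `D`; these two vectors differ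
  -- by at most `ε₁ + ε₂`.
  have i₆ : -(2 * G * B ^ 2 * (ε₁ + ε₂)) ≤ a₁ * l₁ * ⟪p₆, D⟫ := by
    have h1 : 0 ≤ ⟪p₆, y₁' - y₂'⟫ := subdiff_monotone hz₁ hz₂
    have h2 : ‖D - (y₁' - y₂')‖ ≤ ε₁ + ε₂ := by
      rw [show D - (y₁' - y₂') = (y₂' - x₂) - (y₁' - x₁) by rw [hD]; abel]
      exact (norm_sub_le _ _).trans (by linarith)
    have h3 : ‖p₆‖ ≤ 2 * G := (norm_sub_le _ _).trans (by linarith)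
    have h4 := neg_le_inner_of_norm_le h3 h2
    have h5 : ⟪p₆, D⟫ = ⟪p₆, y₁' - y₂'⟫ + ⟪p₆, D - (y₁' - y₂')⟫ := by
      rw [← inner_add_right]; congr 1; abel
    have h6 : a₁ * l₁ ≤ B ^ 2 := by
      rw [sq]; exact mul_le_mul ha₁.2 hl₁.2 hl₁.1 hB
    have h7 : 0 ≤ a₁ * l₁ := mul_nonneg ha₁.1 hl₁.1
    have h8 : 0 ≤ (ε₁ + ε₂) * (2 * G) := by positivity
    have h9 : -((ε₁ + ε₂) * (2 * G)) ≤ ⟪p₆, D⟫ := by linarith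
    have h10 := mul_le_mul_of_nonneg_left h9 h7
    have h11 := mul_le_mul_of_nonneg_right h6 h8
    linarith
  have i₁ := neg_le_inner_of_norm_le n₁ hDρ
  have i₃ := neg_le_inner_of_norm_le n₃ hDρ
  have i₄ := neg_le_inner_of_norm_le n₄ hDρ
  have i₅ := neg_le_inner_of_norm_le n₅ hDρ
  have i₇ := neg_le_inner_of_norm_le n₇ hDρ
  have hexp : ⟪D, v₁ - v₂⟫ = -(⟪p₁, D⟫ + a₁ * ⟪p₂, D⟫ + ⟪p₃, D⟫ + ⟪p₄, D⟫ + ⟪p₅, D⟫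
      + a₁ * l₁ * ⟪p₆, D⟫ + ⟪p₇, D⟫) := by
    rw [real_inner_comm, hsum]
    simp only [inner_neg_left, inner_add_left, inner_smul_left, conj_trivial]
  rw [hexp]
  set δA := ‖A₁ - A₂‖ with hδA
  set δa := |a₁ - a₂| with hδa
  set δl := |l₁ - l₂| with hδl
  have hδA0 : 0 ≤ δA := norm_nonneg _
  have hδa0 : 0 ≤ δa := abs_nonneg _
  have hδl0 : 0 ≤ δl := abs_nonneg _
  have hβ : 0 ≤ ‖b‖ := norm_nonneg _
  set c₁ := B ^ 3 with hc₁
  set c₂ := B * (B * ρ + ‖b‖) with hc₂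
  set c₃ := B * (2 * B * ρ + ‖b‖) with hc₃
  have hc₁0 : 0 ≤ c₁ := by positivity
  have hc₂0 : 0 ≤ c₂ := by positivity
  have hc₃0 : 0 ≤ c₃ := by positivity
  set c₄ := B * G with hc₄
  have hc₄0 : 0 ≤ c₄ := by positivity
  set c₅ := G * B ^ 2 with hc₅
  have hc₅0 : 0 ≤ c₅ := by positivity
  -- All coefficients are enlarged to one common constant; the difference of the two sides expands
  -- into nonnegative monomials.
  have hbig : c₁ * ε₁ + c₂ * δa + c₃ * δA + c₁ * ε₂ + (c₄ * δl + c₄ * δa)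
      ≤ (c₁ + c₂ + c₃ + 2 * c₄) * (ε₁ + ε₂ + (δA + δa + δl)) := by
    have : 0 ≤ (c₁ + c₂ + c₃ + 2 * c₄) * (ε₁ + ε₂ + (δA + δa + δl))
      - (c₁ * ε₁ + c₂ * δa + c₃ * δA + c₁ * ε₂ + (c₄ * δl + c₄ * δa)) := by
      ring_nf
      positivity
    linarith
  have hbig' := mul_le_mul_of_nonneg_left hbig (by positivity : (0 : ℝ) ≤ 2 * ρ)
  have hbig'' : c₅ * (ε₁ + ε₂) ≤ c₅ * (ε₁ + ε₂ + (δA + δa + δl)) := by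
    refine mul_le_mul_of_nonneg_left ?_ hc₅0
    linarith
  have hK : compareConst B ‖b‖ ρ G = 2 * (2 * ρ * (c₁ + c₂ + c₃ + 2 * c₄) + 2 * c₅) := by
    unfold compareConst
    rw [hc₁, hc₂, hc₃, hc₄, hc₅]
    ring
  have j₆ : 2 * G * B ^ 2 * (ε₁ + ε₂) = 2 * (c₅ * (ε₁ + ε₂)) := by rw [hc₅]; ring
  have j₇ : 2 * ρ * ((B * δl + B * δa) * G) = 2 * ρ * (c₄ * δl + c₄ * δa) := by rw [hc₄]; ring
  rw [j₆] at i₆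
  rw [j₇] at i₇
  rw [hK]
  linarith

theorem absolutelyContinuousOnInterval_norm_sq {E : Type*} [NormedAddCommGroup E]
    [NormedSpace ℝ E] {f : ℝ → E} {a c : ℝ} (hf : AbsolutelyContinuousOnInterval f a c) :
    AbsolutelyContinuousOnInterval (fun t => ‖f t‖ ^ 2) a c := by
  have h1 : AbsolutelyContinuousOnInterval (fun t => ‖f t‖) a c := by
    refine squeeze_zero (fun _ => Finset.sum_nonneg fun _ _ => dist_nonneg)
      (fun _ => Finset.sum_le_sum fun _ _ => ?_) hf
    exact (dist_norm_norm_le _ _).trans_eq (dist_eq_norm _ _).symm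
  have h2 := h1.mul h1
  simp only [sq]
  exact h2

/-- Approximate solutions depend continuously on the parameters. -/
theorem norm_sub_sq_le {B ρ G ε₁ ε₂ : ℝ} (hT : 0 ≤ T)
    {A₁ A₂ : ℝ → Mat m n} {α₁ α₂ lam₁ lam₂ : ℝ → ℝ} {x₁ x₂ : ℝ → Vec n}
    (hG : SubdiffBound R ρ G) (hK : 0 ≤ compareConst B ‖b‖ ρ G) (hε : 0 ≤ ε₁ + ε₂)
    (hp₁ : IsParam T B A₁ α₁ lam₁) (hp₂ : IsParam T B A₂ α₂ lam₂)
    (h₁ : IsApproxState R T b ε₁ ρ A₁ α₁ lam₁ x₁) (h₂ : IsApproxState R T b ε₂ ρ A₂ α₂ lam₂ x₂)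
    (h0 : x₁ 0 = x₂ 0) {t : ℝ} (ht : t ∈ Set.Icc 0 T) :
    ‖x₁ t - x₂ t‖ ^ 2 ≤ compareConst B ‖b‖ ρ G *
      ((ε₁ + ε₂) * T + ∫ s in Set.Icc 0 T, paramDist A₁ A₂ α₁ α₂ lam₁ lam₂ s) := by
  set K := compareConst B ‖b‖ ρ G with hKdef
  set d := paramDist A₁ A₂ α₁ α₂ lam₁ lam₂ with hd
  have hac : AbsolutelyContinuousOnInterval (fun s => ‖x₁ s - x₂ s‖ ^ 2) 0 t := by
    refine (absolutelyContinuousOnInterval_norm_sq (h₁.absCont.sub h₂.absCont)).mono ?_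
    rw [Set.uIcc_of_le ht.1, Set.uIcc_of_le hT]
    exact Set.Icc_subset_Icc_right ht.2
  have hdint : IntegrableOn d (Set.Icc 0 T) := hp₁.integrableOn_paramDist hp₂
  have hg : IntegrableOn (fun s => K * (ε₁ + ε₂ + d s)) (Set.Icc 0 T) :=
    ((integrable_const (ε₁ + ε₂)).add hdint).const_mul K
  have hsub : Set.Icc 0 t ⊆ Set.Icc 0 T := Set.Icc_subset_Icc_right ht.2
  -- The squared distance is absolutely continuous and vanishes at `0`, so it is the integral of its
  -- derivative, which `inner_velocity_le` bounds almost everywhere.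
  have hle : ∫ s in (0 : ℝ)..t, deriv (fun s => ‖x₁ s - x₂ s‖ ^ 2) s
      ≤ ∫ s in (0 : ℝ)..t, K * (ε₁ + ε₂ + d s) := by
    refine intervalIntegral.integral_mono_ae_restrict ht.1 hac.intervalIntegrable_deriv
      ((intervalIntegrable_iff_integrableOn_Icc_of_le ht.1).2 (hg.mono_set hsub)) ?_
    refine ae_restrict_of_ae_restrict_of_subset hsub ?_
    filter_upwards [hp₁.bound, hp₂.bound, h₁.ae_inclusion, h₂.ae_inclusion] with s b₁ b₂ i₁ i₂
    obtain ⟨v₁, y₁, y₁', z₁, hv₁, hz₁, a₁, a₁', c₁, c₁', e₁⟩ := i₁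
    obtain ⟨v₂, y₂, y₂', z₂, hv₂, hz₂, a₂, a₂', c₂, c₂', e₂⟩ := i₂
    have hder : HasDerivAt (fun s => ‖x₁ s - x₂ s‖ ^ 2) _ s := (hv₁.sub hv₂).norm_sq
    rw [hder.deriv]
    exact inner_velocity_le b₁.1 b₂.1 b₁.2.1 b₂.2.1 b₁.2.2 b₂.2.2 hG hz₁ hz₂ a₁ a₂ a₁' a₂'
      c₁ c₂ c₁' c₂' e₁ e₂
  rw [hac.integral_deriv_eq_sub, h0, sub_self, norm_zero, zero_pow two_ne_zero, sub_zero] at hle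
  refine hle.trans ?_
  rw [intervalIntegral.integral_of_le ht.1, ← integral_Icc_eq_integral_Ioc]
  calc ∫ s in Set.Icc 0 t, K * (ε₁ + ε₂ + d s)
      ≤ ∫ s in Set.Icc 0 T, K * (ε₁ + ε₂ + d s) := by
        refine setIntegral_mono_set hg (Eventually.of_forall fun s => ?_) hsub.eventuallyLE
        exact mul_nonneg hK (add_nonneg hε (paramDist_nonneg _ _ _ _ _ _ _))
    _ = K * ((ε₁ + ε₂) * T + ∫ s in Set.Icc 0 T, d s) := by
        rw [integral_const_mul, integral_add (integrable_const _) hdint]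
        simp [hT, mul_comm]

end Comparison

/-! ### Cell averages and their convergence in `L¹`. -/

section StepFunctions

variable {X : Type*} [NormedAddCommGroup X] [NormedSpace ℝ X]

/-- The function with value `c k` on the cell `[k h, (k + 1) h)`. -/
def stepFun {Y : Type*} (h : ℝ) (c : ℕ → Y) (t : ℝ) : Y := c ⌊t / h⌋₊

/-- The average over the cell `[k h, (k + 1) h]`. -/
def cellAvg (h : ℝ) (f : ℝ → X) (k : ℕ) : X := ⨍ s in Set.Icc (k * h) ((k + 1) * h), f s

theorem stepFun_eq {Y : Type*} {h : ℝ} (hh : 0 < h) (c : ℕ → Y) {k : ℕ} {t : ℝ}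
    (ht : t ∈ Set.Ico (k * h) ((k + 1) * h)) : stepFun h c t = c k := by
  unfold stepFun
  congr 1
  rw [Nat.floor_eq_iff (div_nonneg ((by positivity : (0 : ℝ) ≤ k * h).trans ht.1) hh.le),
    le_div_iff₀ hh, div_lt_iff₀ hh]
  exact ht

theorem mem_cell_floor {h : ℝ} (hh : 0 < h) {t : ℝ} (ht : 0 ≤ t) :
    t ∈ Set.Ico (⌊t / h⌋₊ * h) ((⌊t / h⌋₊ + 1) * h) :=
  ⟨(le_div_iff₀ hh).1 (Nat.floor_le (by positivity)), (div_lt_iff₀ hh).1 (Nat.lt_floor_add_one _)⟩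

theorem floor_lt_of_mem_Ico {T : ℝ} {N : ℕ} (hN : 0 < N) {t : ℝ} (ht : t ∈ Set.Ico 0 T) :
    ⌊t / (T / N)⌋₊ < N := by
  have hT : 0 < T := ht.1.trans_lt ht.2
  have hN' : (0 : ℝ) < N := by exact_mod_cast hN
  rw [Nat.floor_lt (div_nonneg ht.1 (by positivity)), div_lt_iff₀ (by positivity)]
  calc t < T := ht.2
    _ = N * (T / N) := by field_simp

theorem cell_subset_Icc {T : ℝ} (hT : 0 ≤ T) {N k : ℕ} (hk : k < N) :
    Set.Icc (k * (T / N)) ((k + 1) * (T / N)) ⊆ Set.Icc 0 T := by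
  have hN' : (0 : ℝ) < N := by exact_mod_cast (Nat.zero_le k).trans_lt hk
  have hk' : (k : ℝ) + 1 ≤ N := by exact_mod_cast hk
  refine Set.Icc_subset_Icc (by positivity) ?_
  calc ((k : ℝ) + 1) * (T / N) ≤ N * (T / N) := by gcongr
    _ = T := by field_simp

theorem volume_cell (h : ℝ) (k : ℕ) :
    volume (Set.Icc (k * h) ((k + 1) * h)) = ENNReal.ofReal h := by
  rw [Real.volume_Icc]; congr 1; ring

/-- Half-open and closed cells differ by a null set, and the last cell ends at `N (T / N) = T`. -/
theorem proj_eq_cellAvg {T : ℝ} {N : ℕ} (V : ℝ → X) (k : Fin N) :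
    proj T N V k = cellAvg (T / N) V k := by
  have hN' : (0 : ℝ) < N := by exact_mod_cast (Nat.zero_le _).trans_lt k.2
  unfold proj cellAvg
  refine setAverage_congr ?_
  unfold cell
  split_ifs with h
  · have h' : ((k : ℕ) : ℝ) + 1 = N := by exact_mod_cast h
    rw [h', mul_div_cancel₀ _ hN'.ne']
    rfl
  · exact Ico_ae_eq_Icc

theorem stronglyMeasurable_stepFun {Y : Type*} [TopologicalSpace Y] (h : ℝ) (c : ℕ → Y) : StronglyMeasurable (stepFun h c) :=
  (StronglyMeasurable.of_discrete (f := c)).comp_measurable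
    (Nat.measurable_floor.comp (measurable_id.div_const h))

theorem integrableOn_stepFun {Y : Type*} [NormedAddCommGroup Y] {h : ℝ} (hh : 0 ≤ h) (c : ℕ → Y)
    (a T : ℝ) :
    IntegrableOn (stepFun h c) (Set.Icc a T) := by
  refine Measure.integrableOn_of_bounded (M := ∑ k ∈ Finset.range (⌊T / h⌋₊ + 1), ‖c k‖) (by simp)
    (stronglyMeasurable_stepFun h c).aestronglyMeasurable ?_
  filter_upwards [ae_restrict_mem measurableSet_Icc] with t ht
  refine Finset.single_le_sum (f := fun k => ‖c k‖) (fun _ _ => norm_nonneg _) ?_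
  rw [Finset.mem_range, Nat.lt_succ_iff]
  refine Nat.floor_mono ?_
  gcongr
  exact ht.2

theorem integral_stepFun [CompleteSpace X] {T : ℝ} (hT : 0 < T) {N : ℕ} (hN : 0 < N) (c : ℕ → X) :
    ∫ t in Set.Icc 0 T, stepFun (T / N) c t = (T / N) • ∑ k ∈ Finset.range N, c k := by
  set h := T / N with hh
  have hN' : (0 : ℝ) < N := by exact_mod_cast hN
  have hpos : 0 < h := by positivity
  have hTN : T = (N : ℝ) * h := by rw [hh]; field_simp
  have hcell (k : ℕ) : ∫ t in ((k : ℝ) * h)..((k + 1 : ℕ) : ℝ) * h, stepFun h c t = h • c k := by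
    rw [intervalIntegral.integral_of_le (by gcongr; simp), integral_Ioc_eq_integral_Ioo,
      setIntegral_congr_fun (g := fun _ => c k) measurableSet_Ioo (fun t ht => ?_),
      setIntegral_const]
    · congr 1
      rw [Measure.real, Real.volume_Ioo, ENNReal.toReal_ofReal] <;> push_cast <;> nlinarith
    · exact stepFun_eq hpos c ⟨ht.1.le, by simpa using ht.2⟩
  rw [integral_Icc_eq_integral_Ioc, ← intervalIntegral.integral_of_le hT.le, Finset.smul_sum]
  have h1 := intervalIntegral.sum_integral_adjacent_intervals (μ := volume) (f := stepFun h c)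
    (a := fun k : ℕ => (k : ℝ) * h) (n := N) (fun k _ => by
      rw [intervalIntegrable_iff_integrableOn_Icc_of_le (by gcongr; simp)]
      exact integrableOn_stepFun hpos.le _ _ _)
  simp only [hcell, Nat.cast_zero, zero_mul] at h1
  rw [h1, ← hTN]

/-- An average stays in a closed convex set; applied to balls and to `[0, B]`, this transfers norm
bounds and signs to the projected parameters. -/
theorem cellAvg_mem [CompleteSpace X] {T : ℝ} (hT : 0 < T) {f : ℝ → X}
    (hf : IntegrableOn f (Set.Icc 0 T)) {s : Set X} (hs : Convex ℝ s) (hsc : IsClosed s)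
    (h : ∀ᵐ t ∂(volume.restrict (Set.Icc 0 T)), f t ∈ s) {N k : ℕ} (hk : k < N) :
    cellAvg (T / N) f k ∈ s := by
  have hN' : (0 : ℝ) < N := by exact_mod_cast (Nat.zero_le k).trans_lt hk
  have hsub := cell_subset_Icc hT.le hk
  refine hs.set_average_mem hsc ?_ ?_ (ae_restrict_of_ae_restrict_of_subset hsub h)
    (hf.mono_set hsub)
  · rw [volume_cell]; simp; positivity
  · rw [volume_cell]; simp

theorem cellAvg_sub {T : ℝ} (hT : 0 ≤ T) {f g : ℝ → X} (hf : IntegrableOn f (Set.Icc 0 T))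
    (hg : IntegrableOn g (Set.Icc 0 T)) {N k : ℕ} (hk : k < N) :
    cellAvg (T / N) (fun t => f t - g t) k = cellAvg (T / N) f k - cellAvg (T / N) g k := by
  have hsub := cell_subset_Icc hT hk
  unfold cellAvg
  rw [setAverage_eq, setAverage_eq, setAverage_eq, ← smul_sub,
    integral_sub (hf.mono_set hsub) (hg.mono_set hsub)]

theorem norm_cellAvg_le {h : ℝ} (hh : 0 < h) (f : ℝ → X) (k : ℕ) :
    h * ‖cellAvg h f k‖ ≤ ∫ t in Set.Icc (k * h) ((k + 1) * h), ‖f t‖ := by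
  unfold cellAvg
  rw [setAverage_eq, Measure.real, volume_cell, ENNReal.toReal_ofReal hh.le, norm_smul,
    Real.norm_of_nonneg (by positivity), ← mul_assoc, mul_inv_cancel₀ hh.ne', one_mul]
  exact norm_integral_le_integral_norm _

theorem integral_norm_stepFun_cellAvg_le {T : ℝ} (hT : 0 < T) {N : ℕ} (hN : 0 < N) {f : ℝ → X}
    (hf : IntegrableOn f (Set.Icc 0 T)) :
    ∫ t in Set.Icc 0 T, ‖stepFun (T / N) (cellAvg (T / N) f) t‖ ≤ ∫ t in Set.Icc 0 T, ‖f t‖ := by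
  have hN' : (0 : ℝ) < N := by exact_mod_cast hN
  set h := T / N with hh
  have hpos : 0 < h := by positivity
  have hTN : T = (N : ℝ) * h := by rw [hh]; field_simp
  have h1 := integral_stepFun hT hN fun k => ‖cellAvg h f k‖
  have h2 := intervalIntegral.sum_integral_adjacent_intervals (μ := volume) (f := fun t => ‖f t‖)
    (a := fun k : ℕ => (k : ℝ) * h) (n := N) (fun k hk => by
      rw [intervalIntegrable_iff_integrableOn_Icc_of_le (by gcongr; simp)]
      have := cell_subset_Icc hT.le hk
      push_cast
      exact IntegrableOn.mono_set hf.norm this)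
  simp only [Nat.cast_zero, zero_mul, ← hTN] at h2
  rw [integral_Icc_eq_integral_Ioc (f := fun t => ‖f t‖), ← intervalIntegral.integral_of_le hT.le,
    ← h2]
  refine h1.trans_le ?_
  rw [smul_eq_mul, Finset.mul_sum]
  refine Finset.sum_le_sum fun k _ => (norm_cellAvg_le hpos f k).trans_eq ?_
  rw [intervalIntegral.integral_of_le (by gcongr; simp), ← integral_Icc_eq_integral_Ioc]
  push_cast
  rfl

/-- Lebesgue differentiation along intervals that contain `t` but are not centred at it, hence the
version for doubling measures. The point `t = T` is discarded, since its floor index is `N` and that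
cell leaves `[0, T]`. -/
theorem ae_tendsto_stepFun_cellAvg [CompleteSpace X] {T : ℝ} {f : ℝ → X}
    (hf : IntegrableOn f (Set.Icc 0 T)) :
    ∀ᵐ t ∂(volume.restrict (Set.Icc 0 T)),
      Tendsto (fun N : ℕ => stepFun (T / N) (cellAvg (T / N) f) t) atTop (𝓝 (f t)) := by
  set g := (Set.Icc 0 T).indicator f with hg
  have hgi : Integrable g := hf.integrable_indicator measurableSet_Icc
  have h1 := IsUnifLocDoublingMeasure.ae_tendsto_average volume hgi.locallyIntegrable 1
  have h2 : ∀ᵐ t : ℝ, t ≠ T := by simp [ae_iff]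
  filter_upwards [ae_restrict_of_ae h1, ae_restrict_of_ae h2, ae_restrict_mem measurableSet_Icc]
    with t ht htT htm
  have hIco : t ∈ Set.Ico 0 T := ⟨htm.1, lt_of_le_of_ne htm.2 htT⟩
  have hT : 0 < T := hIco.1.trans_lt hIco.2
  have hball (N : ℕ) : Metric.closedBall (((⌊t / (T / N)⌋₊ : ℝ) + 1 / 2) * (T / N)) (T / N / 2)
      = Set.Icc ((⌊t / (T / N)⌋₊ : ℝ) * (T / N)) ((⌊t / (T / N)⌋₊ + 1) * (T / N)) := by
    rw [Real.closedBall_eq_Icc]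
    congr 1 <;> ring
  have hlim : Tendsto (fun N : ℕ => T / N / 2) atTop (𝓝[>] 0) := by
    refine tendsto_nhdsWithin_iff.2 ⟨?_, ?_⟩
    · have := (tendsto_const_div_atTop_nhds_zero_nat T).div_const 2
      simpa using this
    · filter_upwards [eventually_gt_atTop 0] with N hN
      have hN' : (0 : ℝ) < N := by exact_mod_cast hN
      exact Set.mem_Ioi.2 (by positivity)
  have h3 := ht (fun N : ℕ => ((⌊t / (T / N)⌋₊ : ℝ) + 1 / 2) * (T / N)) (fun N : ℕ => T / N / 2) hlim
    (by
      filter_upwards [eventually_gt_atTop 0] with N hN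
      have hN' : (0 : ℝ) < N := by exact_mod_cast hN
      rw [one_mul, hball]
      exact Set.Ico_subset_Icc_self (mem_cell_floor (by positivity) htm.1))
  have h4 : g t = f t := Set.indicator_of_mem htm f
  rw [h4] at h3
  refine h3.congr' ?_
  filter_upwards [eventually_gt_atTop 0] with N hN
  rw [hball]
  unfold stepFun cellAvg
  rw [setAverage_eq, setAverage_eq]
  congr 1
  refine setIntegral_congr_fun measurableSet_Icc fun s hs => ?_
  exact Set.indicator_of_mem (cell_subset_Icc hT.le (floor_lt_of_mem_Ico hN hIco) hs) f

theorem ae_stepFun_cellAvg_mem [CompleteSpace X] {T : ℝ} (hT : 0 < T) {f : ℝ → X}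
    (hf : IntegrableOn f (Set.Icc 0 T)) {s : Set X} (hs : Convex ℝ s) (hsc : IsClosed s)
    (h : ∀ᵐ t ∂(volume.restrict (Set.Icc 0 T)), f t ∈ s) {N : ℕ} (hN : 0 < N) :
    ∀ᵐ t ∂(volume.restrict (Set.Icc 0 T)), stepFun (T / N) (cellAvg (T / N) f) t ∈ s := by
  have h2 : ∀ᵐ t : ℝ, t ≠ T := by simp [ae_iff]
  filter_upwards [ae_restrict_of_ae h2, ae_restrict_mem measurableSet_Icc] with t htT htm
  exact cellAvg_mem hT hf hs hsc h
    (floor_lt_of_mem_Ico hN ⟨htm.1, lt_of_le_of_ne htm.2 htT⟩)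

/-- Averages of bounded functions that converge in `L¹` converge in `L¹`. -/
theorem tendsto_integral_norm_stepFun_sub [CompleteSpace X] {T B : ℝ} (hT : 0 < T)
    {f : ℕ → ℝ → X} {g : ℝ → X} (hf : ∀ N, 1 ≤ N → IntegrableOn (f N) (Set.Icc 0 T))
    (hg : IntegrableOn g (Set.Icc 0 T))
    (hgB : ∀ᵐ t ∂(volume.restrict (Set.Icc 0 T)), ‖g t‖ ≤ B)
    (hfg : Tendsto (fun N => ∫ t in Set.Icc 0 T, ‖f N t - g t‖) atTop (𝓝 0)) :
    Tendsto (fun N : ℕ => ∫ t in Set.Icc 0 T,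
      ‖stepFun (T / N) (cellAvg (T / N) (f N)) t - g t‖) atTop (𝓝 0) := by
  -- With `P` the averaging operator, `P f - g = P (f - g) + (P g - g)`. The second term tends to
  -- zero by dominated convergence, the first by the `L¹` contraction property.
  have h1 : Tendsto (fun N : ℕ => ∫ t in Set.Icc 0 T,
      ‖stepFun (T / N) (cellAvg (T / N) g) t - g t‖) atTop (𝓝 0) := by
    suffices Tendsto (fun N : ℕ => ∫ t in Set.Icc 0 T,
        ‖stepFun (T / N) (cellAvg (T / N) g) t - g t‖) atTop
        (𝓝 (∫ _ in Set.Icc 0 T, (0 : ℝ))) by simpa using this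
    refine tendsto_integral_filter_of_dominated_convergence (fun _ => B + B) ?_ ?_
      (integrable_const (μ := volume.restrict (Set.Icc 0 T)) _) ?_
    · exact Eventually.of_forall fun N =>
        ((integrableOn_stepFun (by positivity) _ _ _).sub hg).norm.aestronglyMeasurable
    · filter_upwards [eventually_gt_atTop 0] with N hN
      have h2 := ae_stepFun_cellAvg_mem hT hg (convex_closedBall 0 B) Metric.isClosed_closedBall
        (by simpa using hgB) hN
      filter_upwards [h2, hgB] with t ht ht'
      rw [norm_norm]
      exact (norm_sub_le _ _).trans (add_le_add (by simpa using ht) ht')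
    · filter_upwards [ae_tendsto_stepFun_cellAvg hg] with t ht
      exact tendsto_iff_norm_sub_tendsto_zero.1 ht
  have h3 := hfg.add h1
  rw [add_zero] at h3
  refine squeeze_zero' (Eventually.of_forall fun N => integral_nonneg fun t => norm_nonneg _) ?_ h3
  filter_upwards [eventually_ge_atTop 1] with N hN
  have i1 : IntegrableOn (fun t => ‖f N t - g t‖) (Set.Icc 0 T) := ((hf N hN).sub hg).norm
  have h4 := integral_norm_stepFun_cellAvg_le hT hN ((hf N hN).sub hg)
  have i2 : IntegrableOn (fun t => ‖stepFun (T / N)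
      (cellAvg (T / N) (fun t => f N t - g t)) t‖) (Set.Icc 0 T) :=
    (integrableOn_stepFun (by positivity) _ _ _).norm
  have i3 : IntegrableOn (fun t => ‖stepFun (T / N) (cellAvg (T / N) g) t - g t‖) (Set.Icc 0 T) :=
    ((integrableOn_stepFun (by positivity) _ _ _).sub hg).norm
  calc ∫ t in Set.Icc 0 T, ‖stepFun (T / N) (cellAvg (T / N) (f N)) t - g t‖
      ≤ ∫ t in Set.Icc 0 T, (‖stepFun (T / N) (cellAvg (T / N) (fun t => f N t - g t)) t‖
          + ‖stepFun (T / N) (cellAvg (T / N) g) t - g t‖) := by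
        refine integral_mono_ae ((integrableOn_stepFun (by positivity) _ _ _).sub hg).norm (i2.add i3) ?_
        have h2 : ∀ᵐ t : ℝ, t ≠ T := by simp [ae_iff]
        filter_upwards [ae_restrict_of_ae h2, ae_restrict_mem measurableSet_Icc] with t htT htm
        have hk := floor_lt_of_mem_Ico hN ⟨htm.1, lt_of_le_of_ne htm.2 htT⟩
        have e : stepFun (T / N) (cellAvg (T / N) (f N)) t - g t
            = stepFun (T / N) (cellAvg (T / N) (fun t => f N t - g t)) t
              + (stepFun (T / N) (cellAvg (T / N) g) t - g t) := by
          unfold stepFun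
          rw [cellAvg_sub hT.le (hf N hN) hg hk]
          abel
        rw [e]
        exact norm_add_le _ _
    _ ≤ _ := by
        rw [integral_add i2 i3]
        exact add_le_add h4 le_rfl

end StepFunctions

/-! ### Piecewise linear interpolation. -/

section Interpolation

variable {E : Type*} [NormedAddCommGroup E] [NormedSpace ℝ E]

/-- The projection of `ℝ` onto `[0, 1]`. -/
def clamp (τ : ℝ) : ℝ := max 0 (min 1 τ)

theorem clamp_mono : Monotone clamp := fun _ _ h => max_le_max le_rfl (min_le_min le_rfl h)

/-- The `k`-th ramp rises exactly on `[k, k + 1]`, so the ramps add up to the truncation to `[0,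
N]`. -/
theorem sum_clamp (N : ℕ) (τ : ℝ) :
    ∑ k ∈ Finset.range N, clamp (τ - k) = max 0 (min (N : ℝ) τ) := by
  induction N with
  | zero => simp
  | succ N ih =>
    have hN : (0 : ℝ) ≤ N := Nat.cast_nonneg N
    rw [Finset.sum_range_succ, ih]
    unfold clamp
    push_cast
    rcases le_total τ 0 with h | h
    · rw [min_eq_right (by linarith), min_eq_right (by linarith), min_eq_right (by linarith),
        max_eq_left h, max_eq_left (by linarith), add_zero]
    · rcases le_total τ N with h1 | h1
      · rw [min_eq_right h1, min_eq_right (by linarith), min_eq_right (by linarith),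
          max_eq_right h, max_eq_left (by linarith), add_zero]
      · rcases le_total τ (N + 1) with h2 | h2
        · rw [min_eq_left h1, min_eq_right (by linarith), min_eq_right h2,
            max_eq_right hN, max_eq_right (by linarith), max_eq_right h]
          ring
        · rw [min_eq_left h1, min_eq_left (by linarith), min_eq_left h2,
            max_eq_right hN, max_eq_right (by linarith), max_eq_right (by linarith)]

/-- The piecewise linear interpolation of `x 0, …, x N` at the nodes `k h`. -/
def interp (h : ℝ) (N : ℕ) (x : ℕ → E) (t : ℝ) : E :=
  x 0 + ∑ k ∈ Finset.range N, clamp (t / h - k) • (x (k + 1) - x k)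

theorem interp_eq {h : ℝ} (hh : 0 < h) {N k : ℕ} (hk : k < N) (x : ℕ → E) {t : ℝ}
    (ht : t ∈ Set.Icc (k * h) ((k + 1) * h)) :
    interp h N x t = x k + (t / h - k) • (x (k + 1) - x k) := by
  have h1 : (k : ℝ) ≤ t / h := (le_div_iff₀ hh).2 ht.1
  have h2 : t / h ≤ k + 1 := (div_le_iff₀ hh).2 ht.2
  have hsub : Finset.range (k + 1) ⊆ Finset.range N := by
    intro j; simp only [Finset.mem_range]; omega
  unfold interp
  rw [← Finset.sum_subset hsub, Finset.sum_range_succ]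
  · have h3 : clamp (t / h - k) = t / h - k := by
      unfold clamp
      rw [min_eq_right (by linarith), max_eq_right (by linarith)]
    rw [h3, Finset.sum_congr rfl (g := fun j => x (j + 1) - x j), Finset.sum_range_sub]
    · abel
    · intro j hj
      have hj' : (j : ℝ) + 1 ≤ k := by exact_mod_cast Finset.mem_range.1 hj
      unfold clamp
      rw [min_eq_left (by linarith), max_eq_right zero_le_one, one_smul]
  · intro j _ hj
    have hj' : (k : ℝ) + 1 ≤ j := by
      rw [Finset.mem_range, not_lt] at hj; exact_mod_cast hj
    unfold clamp
    rw [min_eq_right (by linarith), max_eq_left (by linarith), zero_smul]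

/-- Between `s` and `t` each increment is weighted by the rise of its ramp, and by `sum_clamp` the
weights add up to at most `(t - s) / h`. The cells containing `s` and `t` need not be located. -/
theorem norm_interp_sub_le {h C : ℝ} (hh : 0 < h) {N : ℕ} (hN : 0 < N) {x : ℕ → E}
    (hx : ∀ k < N, ‖x (k + 1) - x k‖ ≤ h * C) (s t : ℝ) :
    ‖interp h N x t - interp h N x s‖ ≤ C * |t - s| := by
  have hC : 0 ≤ h * C := (norm_nonneg _).trans (hx 0 hN)
  wlog hst : s ≤ t generalizing s t
  · rw [norm_sub_rev, abs_sub_comm]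
    exact this t s (le_of_not_ge hst)
  have hst' : s / h ≤ t / h := by gcongr
  have h1 (k : ℕ) : 0 ≤ clamp (t / h - k) - clamp (s / h - k) :=
    sub_nonneg.2 (clamp_mono (by linarith))
  have h2 : interp h N x t - interp h N x s
      = ∑ k ∈ Finset.range N, (clamp (t / h - k) - clamp (s / h - k)) • (x (k + 1) - x k) := by
    unfold interp
    simp only [sub_smul _ _ (_ - _ : E), Finset.sum_sub_distrib]
    abel
  rw [h2]
  calc ‖∑ k ∈ Finset.range N, (clamp (t / h - k) - clamp (s / h - k)) • (x (k + 1) - x k)‖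
      ≤ ∑ k ∈ Finset.range N, (clamp (t / h - k) - clamp (s / h - k)) * (h * C) := by
        refine norm_sum_le_of_le _ fun k hk => ?_
        rw [norm_smul, Real.norm_of_nonneg (h1 k)]
        exact mul_le_mul_of_nonneg_left (hx k (Finset.mem_range.1 hk)) (h1 k)
    _ = (max 0 (min (N : ℝ) (t / h)) - max 0 (min (N : ℝ) (s / h))) * (h * C) := by
        rw [← Finset.sum_mul, Finset.sum_sub_distrib, sum_clamp, sum_clamp]
    _ ≤ (t / h - s / h) * (h * C) := by
        refine mul_le_mul_of_nonneg_right ?_ hC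
        have h3 := abs_max_sub_max_le_abs (min (N : ℝ) (t / h)) (min (N : ℝ) (s / h)) 0
        have h4 := abs_min_sub_min_le_max (N : ℝ) (t / h) (N : ℝ) (s / h)
        rw [sub_self, abs_zero, max_eq_right (abs_nonneg _),
          abs_of_nonneg (sub_nonneg.2 hst')] at h4
        rw [max_comm, max_comm 0]
        exact (le_abs_self _).trans (h3.trans h4)
    _ = C * |t - s| := by
        rw [abs_of_nonneg (sub_nonneg.2 hst)]
        field_simp

theorem hasDerivAt_interp {h : ℝ} (hh : 0 < h) {N k : ℕ} (hk : k < N) (x : ℕ → E) {t : ℝ}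
    (ht : t ∈ Set.Ioo (k * h) ((k + 1) * h)) :
    HasDerivAt (interp h N x) (h⁻¹ • (x (k + 1) - x k)) t := by
  have h1 : HasDerivAt (fun s : ℝ => x k + (s / h - k) • (x (k + 1) - x k))
      (h⁻¹ • (x (k + 1) - x k)) t := by
    have := ((((hasDerivAt_id t).div_const h).sub_const (k : ℝ)).smul_const
      (x (k + 1) - x k)).const_add (x k)
    simpa using this
  refine h1.congr_of_eventuallyEq ?_
  filter_upwards [isOpen_Ioo.mem_nhds ht] with s hs
  exact interp_eq hh hk x (Set.Ioo_subset_Icc_self hs)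

theorem interp_zero {h : ℝ} (N : ℕ) (x : ℕ → E) : interp h N x 0 = x 0 := by
  unfold interp
  rw [Finset.sum_eq_zero, add_zero]
  intro k _
  have : clamp (0 / h - k) = 0 := by
    unfold clamp
    rw [zero_div, zero_sub, min_eq_right, max_eq_left] <;>
      linarith [(Nat.cast_nonneg k : (0 : ℝ) ≤ k)]
  rw [this, zero_smul]

theorem interp_last {h : ℝ} (hh : 0 < h) {N : ℕ} (x : ℕ → E) : interp h N x (N * h) = x N := by
  rcases N with _ | k
  · simp [interp]
  · rw [interp_eq hh (Nat.lt_succ_self k) x (by push_cast; constructor <;> nlinarith)]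
    have : ((k + 1 : ℕ) : ℝ) * h / h - k = 1 := by
      rw [mul_div_cancel_right₀ _ hh.ne']; push_cast; ring
    rw [this, one_smul]
    abel

end Interpolation

/-! ### Interpolated network states as approximate solutions. -/

section NetworkInterpolation

variable {m n : ℕ} {R : Vec n → ℝ} {T : ℝ} {b : Vec m} {x0 : Vec n} {N : ℕ}

/-- The piecewise linear interpolation of a network state. -/
def networkInterp (T : ℝ) {N : ℕ} (x : Fin (N + 1) → Vec n) : ℝ → Vec n :=
  interp (T / N) N fun k => x ⟨min k N, by omega⟩

theorem networkInterp_zero (x : Fin (N + 1) → Vec n) : networkInterp T x 0 = x 0 := by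
  unfold networkInterp
  rw [interp_zero]
  exact congrArg x (Fin.ext (by simp))

theorem networkInterp_last (hT : 0 < T) (hN : 0 < N) (x : Fin (N + 1) → Vec n) :
    networkInterp T x T = x (Fin.last N) := by
  have hN' : (0 : ℝ) < N := by exact_mod_cast hN
  have h := interp_last (N := N) (by positivity : 0 < T / N) fun k => x ⟨min k N, by omega⟩
  rw [mul_div_cancel₀ _ hN'.ne'] at h
  unfold networkInterp
  rw [h]
  exact congrArg x (Fin.ext (by simp))

theorem norm_networkInterp_sub_le {C : ℝ} (hT : 0 < T) (hN : 0 < N) {x : Fin (N + 1) → Vec n}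
    (hx : ∀ k : Fin N, ‖x k.succ - x k.castSucc‖ ≤ T / N * C) (s t : ℝ) :
    ‖networkInterp T x t - networkInterp T x s‖ ≤ C * |t - s| := by
  have hN' : (0 : ℝ) < N := by exact_mod_cast hN
  refine norm_interp_sub_le (by positivity) hN (fun k hk => ?_) s t
  have e : (⟨min k N, by omega⟩ : Fin (N + 1)) = Fin.castSucc ⟨k, hk⟩ := Fin.ext (by simp; omega)
  have e' : (⟨min (k + 1) N, by omega⟩ : Fin (N + 1)) = Fin.succ ⟨k, hk⟩ :=
    Fin.ext (by simp; omega)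
  rw [e, e']
  exact hx ⟨k, hk⟩

theorem ae_mem_cell (hT : 0 < T) (hN : 0 < N) : ∀ᵐ t ∂(volume.restrict (Set.Icc 0 T)),
    ∃ k < N, t ∈ Set.Ioo ((k : ℝ) * (T / N)) ((k + 1) * (T / N)) := by
  have hN' : (0 : ℝ) < N := by exact_mod_cast hN
  have h1 : ∀ᵐ t : ℝ, t ∉ Set.range fun k : ℕ => (k : ℝ) * (T / N) :=
    (Set.countable_range _).ae_notMem _
  have h2 : ∀ᵐ t : ℝ, t ≠ T := by simp [ae_iff]
  filter_upwards [ae_restrict_of_ae h1, ae_restrict_of_ae h2, ae_restrict_mem measurableSet_Icc]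
    with t ht htT htm
  have h3 := mem_cell_floor (by positivity : 0 < T / N) htm.1
  exact ⟨_, floor_lt_of_mem_Ico hN ⟨htm.1, lt_of_le_of_ne htm.2 htT⟩,
    lt_of_le_of_ne h3.1 fun e => ht ⟨_, e⟩, h3.2⟩

/-- The interpolation of a network state solves the inclusion approximately at almost every
time. -/
theorem IsNetworkState.ae_networkInterp {ρ C : ℝ} (hT : 0 < T) (hN : 0 < N)
    {A : ℕ → Mat m n} {α lam : ℕ → ℝ} {x : Fin (N + 1) → Vec n}
    (hx : IsNetworkState R T b x0 (fun k : Fin N => A k) (fun k => α k) (fun k => lam k) x)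
    (hρ : ∀ i, ‖x i‖ ≤ ρ) (hC : ∀ k : Fin N, ‖x k.succ - x k.castSucc‖ ≤ T / N * C) :
    ∀ᵐ t ∂(volume.restrict (Set.Icc 0 T)), ∃ v y y' z : Vec n,
      HasDerivAt (networkInterp T x) v t ∧ z ∈ subdiff R y' ∧
      ‖y - networkInterp T x t‖ ≤ T / N * C ∧ ‖y' - networkInterp T x t‖ ≤ T / N * C ∧
      ‖networkInterp T x t‖ ≤ ρ ∧ ‖y'‖ ≤ ρ ∧
      v + stepFun (T / N) α t • gradTerm (stepFun (T / N) A t) b y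
        + (stepFun (T / N) α t * stepFun (T / N) lam t) • z = 0 := by
  have hN' : (0 : ℝ) < N := by exact_mod_cast hN
  have hh : 0 < T / N := by positivity
  filter_upwards [ae_mem_cell hT hN] with t ht
  obtain ⟨k, hk, ht⟩ := ht
  obtain ⟨z, hz, e⟩ := hx.2 ⟨k, hk⟩
  have hCk := hC ⟨k, hk⟩
  -- The gradient is explicit, hence taken at the left node `y`; the subgradient is implicit, hence
  -- taken at the right node `y'`.
  set y := x (Fin.castSucc ⟨k, hk⟩) with hy
  set y' := x (Fin.succ ⟨k, hk⟩) with hy'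
  have ey : x ⟨min k N, by omega⟩ = y := by rw [hy]; congr 1; ext; simp; omega
  have ey' : x ⟨min (k + 1) N, by omega⟩ = y' := by rw [hy']; congr 1; ext; simp; omega
  have hder := hasDerivAt_interp hh hk (fun k => x ⟨min k N, by omega⟩) ht
  have hval : networkInterp T x t = y + (t / (T / N) - k) • (y' - y) := by
    have := interp_eq hh hk (fun k => x ⟨min k N, by omega⟩) (Set.Ioo_subset_Icc_self ht)
    simp only [ey, ey'] at this
    exact this
  simp only [ey, ey'] at hder
  have hIco := Set.Ioo_subset_Ico_self ht
  rw [stepFun_eq hh α hIco, stepFun_eq hh A hIco, stepFun_eq hh lam hIco, hval]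
  set θ := t / (T / N) - k with hθ
  have hθ0 : 0 ≤ θ := sub_nonneg.2 ((le_div_iff₀ hh).2 ht.1.le)
  have hθ1 : θ ≤ 1 := by
    have := (div_le_iff₀ hh).2 ht.2.le
    linarith
  refine ⟨_, y, y', z, hder, hz, ?_, ?_, ?_, hρ _, ?_⟩
  · rw [show y - (y + θ • (y' - y)) = -(θ • (y' - y)) by abel, norm_neg, norm_smul,
      Real.norm_of_nonneg hθ0]
    exact (mul_le_of_le_one_left (norm_nonneg _) hθ1).trans hCk
  · rw [show y' - (y + θ • (y' - y)) = (1 - θ) • (y' - y) by module, norm_smul,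
      Real.norm_of_nonneg (by linarith)]
    exact (mul_le_of_le_one_left (norm_nonneg _) (by linarith)).trans hCk
  · have := (convex_closedBall (0 : Vec n) ρ).add_smul_sub_mem (x := y) (y := y')
      (by simpa using hρ _) (by simpa using hρ _) ⟨hθ0, hθ1⟩
    simpa using this
  · have h2 : (T / N)⁻¹ • ((y' - y) + (T / N * α k) • gradTerm (A k) b y
        + (T / N * α k * lam k) • z) = 0 := by
      rw [e, smul_zero]
    rw [← h2, smul_add, smul_add, smul_smul, smul_smul, mul_assoc (T / N) (α k),
      inv_mul_cancel_left₀ hh.ne', inv_mul_cancel_left₀ hh.ne']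

theorem lipschitzWith_of_norm_sub_le {E : Type*} [NormedAddCommGroup E] {f : ℝ → E} {C : ℝ}
    (h : ∀ s t, ‖f t - f s‖ ≤ C * |t - s|) : LipschitzWith C.toNNReal f := by
  refine LipschitzWith.of_dist_le_mul fun t s => ?_
  rw [dist_eq_norm, dist_eq_norm, Real.norm_eq_abs]
  refine (h s t).trans ?_
  gcongr
  exact Real.le_coe_toNNReal C

theorem IsNetworkState.isApproxState {ρ C : ℝ} (hT : 0 < T) (hN : 0 < N)
    {A : ℕ → Mat m n} {α lam : ℕ → ℝ} {x : Fin (N + 1) → Vec n}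
    (hx : IsNetworkState R T b x0 (fun k : Fin N => A k) (fun k => α k) (fun k => lam k) x)
    (hρ : ∀ i, ‖x i‖ ≤ ρ) (hC : ∀ k : Fin N, ‖x k.succ - x k.castSucc‖ ≤ T / N * C) :
    IsApproxState R T b (T / N * C) ρ (stepFun (T / N) A) (stepFun (T / N) α)
      (stepFun (T / N) lam) (networkInterp T x) :=
  ⟨(lipschitzWith_of_norm_sub_le
      (norm_networkInterp_sub_le hT hN hC)).lipschitzOnWith.absolutelyContinuousOnInterval,
    hx.ae_networkInterp hT hN hρ hC⟩

end NetworkInterpolation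

/-! ### The evolution variational inequality and its equivalence with the inclusion. -/

section EvolutionVariationalInequality

variable {m n : ℕ} {R : Vec n → ℝ} {T B ρ G ε : ℝ} {b : Vec m}
  {A : ℝ → Mat m n} {α lam : ℝ → ℝ} {x : ℝ → Vec n}

/-- The integrand of the evolution variational inequality with test vector `w`. -/
def evi (R : Vec n → ℝ) (b : Vec m) (w : Vec n) (q : Mat m n × ℝ × ℝ × Vec n) : ℝ :=
  q.2.1 * q.2.2.1 * (R w - R q.2.2.2) - q.2.1 * ⟪gradTerm q.1 b q.2.2.2, q.2.2.2 - w⟫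

theorem continuous_evi (hR : Continuous R) (b : Vec m) (w : Vec n) : Continuous (evi R b w) := by
  have h := (continuous_gradTerm (n := n) b).comp
    (continuous_fst.prodMk (continuous_snd.comp (continuous_snd.comp continuous_snd)) :
      Continuous fun q : Mat m n × ℝ × ℝ × Vec n => (q.1, q.2.2.2))
  have h' : Continuous fun q : Mat m n × ℝ × ℝ × Vec n => gradTerm q.1 b q.2.2.2 := h
  unfold evi
  fun_prop

/-- The parameters and the state, as the argument of `evi`. -/
def eviArg (A : ℝ → Mat m n) (α lam : ℝ → ℝ) (x : ℝ → Vec n) (t : ℝ) : Mat m n × ℝ × ℝ × Vec n :=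
  (A t, α t, lam t, x t)

theorem exists_evi_bound (hR : Continuous R) (b : Vec m) (w : Vec n) (B ρ : ℝ) :
    ∃ S, ∀ q : Mat m n × ℝ × ℝ × Vec n, ‖q.1‖ ≤ B → (0 ≤ q.2.1 ∧ q.2.1 ≤ B) →
      (0 ≤ q.2.2.1 ∧ q.2.2.1 ≤ B) → ‖q.2.2.2‖ ≤ ρ → ‖evi R b w q‖ ≤ S := by
  obtain ⟨S, hS⟩ := (isCompact_closedBall (0 : Mat m n × ℝ × ℝ × Vec n)
    (max B ρ)).exists_bound_of_continuousOn (continuous_evi hR b w).continuousOn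
  refine ⟨S, fun q h1 h2 h3 h4 => hS q ?_⟩
  rw [mem_closedBall_zero_iff, Prod.norm_def, Prod.norm_def, Prod.norm_def,
    Real.norm_of_nonneg h2.1, Real.norm_of_nonneg h3.1]
  exact max_le (h1.trans (le_max_left _ _)) (max_le (h2.2.trans (le_max_left _ _))
    (max_le (h3.2.trans (le_max_left _ _)) (h4.trans (le_max_right _ _))))

theorem IsParam.aestronglyMeasurable_evi (hp : IsParam T B A α lam) (hR : Continuous R)
    (hx : ContinuousOn x (Set.Icc 0 T)) (w : Vec n) :
    AEStronglyMeasurable (fun t => evi R b w (eviArg A α lam x t))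
      (volume.restrict (Set.Icc 0 T)) :=
  (continuous_evi hR b w).comp_aestronglyMeasurable
    (hp.integrable_A.aestronglyMeasurable.prodMk (hp.integrable_α.aestronglyMeasurable.prodMk
      (hp.integrable_lam.aestronglyMeasurable.prodMk
        (hx.aestronglyMeasurable measurableSet_Icc))))

theorem IsParam.integrableOn_evi (hp : IsParam T B A α lam) (hR : Continuous R)
    (hx : ContinuousOn x (Set.Icc 0 T)) (w : Vec n) :
    IntegrableOn (fun t => evi R b w (eviArg A α lam x t)) (Set.Icc 0 T) := by
  obtain ⟨ρ, hρ⟩ := isCompact_Icc.exists_bound_of_continuousOn hx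
  obtain ⟨S, hS⟩ := exists_evi_bound (m := m) hR b w B ρ
  refine Integrable.of_bound (hp.aestronglyMeasurable_evi hR hx w) S ?_
  filter_upwards [hp.bound, ae_restrict_mem measurableSet_Icc] with t ht htm
  exact hS _ ht.1 ht.2.1 ht.2.2 (hρ t htm)

/-- The subgradient inequality for `z` produces `R y'` instead of `R x`. A subgradient at `x` gives
`R y' ≥ R x - ε G`, and moving the base point of `⟪z, ·⟫` from `y'` to `x` costs another `ε G`;
hence the term `2 B² G`. Replacing `y` by `x` in the gradient costs the `B³` term. -/
theorem inner_velocity_le_evi {a l : ℝ} {A : Mat m n} {x y y' z v w : Vec n}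
    (hne : (subdiff R x).Nonempty)
    (hA : ‖A‖ ≤ B) (ha : 0 ≤ a ∧ a ≤ B) (hl : 0 ≤ l ∧ l ≤ B) (hG : SubdiffBound R ρ G)
    (hz : z ∈ subdiff R y') (hy : ‖y - x‖ ≤ ε) (hy' : ‖y' - x‖ ≤ ε)
    (hxρ : ‖x‖ ≤ ρ) (hyρ : ‖y'‖ ≤ ρ) (e : v + a • gradTerm A b y + (a * l) • z = 0) :
    ⟪x - w, v⟫ ≤ evi R b w (A, a, l, x) + (2 * B ^ 2 * G + B ^ 3 * (ρ + ‖w‖)) * ε := by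
  obtain ⟨ζ, hζ⟩ := hne
  have hB : 0 ≤ B := ha.1.trans ha.2
  have hε : 0 ≤ ε := (norm_nonneg _).trans hy
  have hζG := hG _ hxρ _ hζ
  have hzG := hG _ hyρ _ hz
  have h1 := hζ y'
  have h2 := hz w
  have h3 := neg_le_inner_of_norm_le hζG hy'
  have h4 := neg_le_inner_of_norm_le hzG ((norm_sub_rev x y').trans_le hy')
  have h5 : ⟪z, x - w⟫ = -⟪z, w - y'⟫ + ⟪z, x - y'⟫ := by
    rw [← inner_neg_right, ← inner_add_right]; congr 1; abel
  have h6 : R x - R w - 2 * (ε * G) ≤ ⟪z, x - w⟫ := by linarith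
  have hal : 0 ≤ a * l := mul_nonneg ha.1 hl.1
  have hal' : a * l ≤ B ^ 2 := by rw [sq]; exact mul_le_mul ha.2 hl.2 hl.1 hB
  have h7 := mul_le_mul_of_nonneg_left h6 hal
  have hG0 : 0 ≤ G := (norm_nonneg _).trans hzG
  have h8 := mul_le_mul_of_nonneg_right hal' (by positivity : 0 ≤ 2 * (ε * G))
  have h9 : ‖a • (gradTerm A b y - gradTerm A b x)‖ ≤ B ^ 3 * ε := by
    rw [norm_smul, Real.norm_of_nonneg ha.1]
    calc a * ‖gradTerm A b y - gradTerm A b x‖ ≤ B * (B * (B * ε)) := by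
          refine mul_le_mul ha.2 ((norm_gradTerm_sub_le _ _ _ _).trans ?_) (norm_nonneg _) hB
          gcongr
      _ = _ := by ring
  have h10 : ‖x - w‖ ≤ ρ + ‖w‖ := (norm_sub_le _ _).trans (by gcongr)
  have h11 := neg_le_inner_of_norm_le h9 h10
  have hv : v = -(a • gradTerm A b x + a • (gradTerm A b y - gradTerm A b x) + (a * l) • z) := by
    rw [← sub_eq_zero, ← e]
    module
  have h12 : ⟪x - w, v⟫ = -(a * ⟪gradTerm A b x, x - w⟫
      + ⟪a • (gradTerm A b y - gradTerm A b x), x - w⟫ + a * l * ⟪z, x - w⟫) := by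
    rw [real_inner_comm, hv]
    simp only [inner_neg_left, inner_add_left, inner_smul_left, conj_trivial]
  rw [h12]
  unfold evi
  simp only
  linarith

/-- Integrated form of `inner_velocity_le_evi`. Only values of the state and of the parameters
remain, so pointwise convergence suffices to pass to the limit. -/
theorem IsApproxState.norm_sq_sub_le (hx : IsApproxState R T b ε ρ A α lam x)
    (hp : IsParam T B A α lam) (hR : Continuous R) (hne : ∀ y, (subdiff R y).Nonempty)
    (hG : SubdiffBound R ρ G) (w : Vec n) {s t : ℝ} (hs : 0 ≤ s) (hst : s ≤ t) (ht : t ≤ T) :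
    ‖x t - w‖ ^ 2 - ‖x s - w‖ ^ 2
      ≤ 2 * ((∫ τ in s..t, evi R b w (eviArg A α lam x τ))
          + (t - s) * ((2 * B ^ 2 * G + B ^ 3 * (ρ + ‖w‖)) * ε)) := by
  have hT : 0 ≤ T := hs.trans (hst.trans ht)
  have hsub : Set.Icc s t ⊆ Set.Icc 0 T := Set.Icc_subset_Icc hs ht
  have hcont : ContinuousOn x (Set.Icc 0 T) := by
    simpa [Set.uIcc_of_le hT] using hx.absCont.continuousOn
  have hac : AbsolutelyContinuousOnInterval (fun τ => ‖x τ - w‖ ^ 2) s t := by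
    have hconst : AbsolutelyContinuousOnInterval (fun _ => w) 0 T :=
      (LipschitzWith.const w).lipschitzOnWith.absolutelyContinuousOnInterval
    refine (absolutelyContinuousOnInterval_norm_sq (hx.absCont.sub hconst)).mono ?_
    rwa [Set.uIcc_of_le hst, Set.uIcc_of_le hT]
  have hint := (hp.integrableOn_evi (b := b) hR hcont w).mono_set hsub
  set c := (2 * B ^ 2 * G + B ^ 3 * (ρ + ‖w‖)) * ε with hc
  have hint' : IntegrableOn (fun τ => evi R b w (eviArg A α lam x τ) + c) (Set.Icc s t) :=
    hint.add (integrable_const c)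
  have hle : ∫ τ in s..t, deriv (fun τ => ‖x τ - w‖ ^ 2) τ
      ≤ ∫ τ in s..t, 2 * (evi R b w (eviArg A α lam x τ) + c) := by
    refine intervalIntegral.integral_mono_ae_restrict hst hac.intervalIntegrable_deriv
      ((intervalIntegrable_iff_integrableOn_Icc_of_le hst).2 (hint'.const_mul 2)) ?_
    refine ae_restrict_of_ae_restrict_of_subset hsub ?_
    filter_upwards [hp.bound, hx.ae_inclusion] with τ hb hi
    obtain ⟨v, y, y', z, hv, hz, a₁, a₂, a₃, a₄, e⟩ := hi
    have hder : HasDerivAt (fun s => ‖x s - w‖ ^ 2) _ τ := (hv.sub_const w).norm_sq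
    rw [hder.deriv]
    exact mul_le_mul_of_nonneg_left
      (inner_velocity_le_evi (hne _) hb.1 hb.2.1 hb.2.2 hG hz a₁ a₂ a₃ a₄ e) zero_le_two
  rw [hac.integral_deriv_eq_sub, intervalIntegral.integral_const_mul,
    intervalIntegral.integral_add
      ((intervalIntegrable_iff_integrableOn_Icc_of_le hst).2 hint) (by simp)] at hle
  simpa using hle

/-- The evolution variational inequality passes to the limit. -/
theorem norm_sq_sub_le_of_tendsto {ε : ℕ → ℝ} {As : ℕ → ℝ → Mat m n} {αs lams : ℕ → ℝ → ℝ}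
    {xs : ℕ → ℝ → Vec n}
    (hx : ∀ N, IsApproxState R T b (ε N) ρ (As N) (αs N) (lams N) (xs N))
    (hps : ∀ N, IsParam T B (As N) (αs N) (lams N))
    (hR : Continuous R) (hne : ∀ y, (subdiff R y).Nonempty) (hG : SubdiffBound R ρ G)
    (hε : Tendsto ε atTop (𝓝 0))
    (hlim : ∀ᵐ t ∂(volume.restrict (Set.Icc 0 T)),
      Tendsto (fun N => eviArg (As N) (αs N) (lams N) (xs N) t) atTop (𝓝 (eviArg A α lam x t)))
    (hxlim : ∀ t ∈ Set.Icc 0 T, Tendsto (fun N => xs N t) atTop (𝓝 (x t)))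
    (w : Vec n) {s t : ℝ} (hs : 0 ≤ s) (hst : s ≤ t) (ht : t ≤ T) :
    ‖x t - w‖ ^ 2 - ‖x s - w‖ ^ 2 ≤ 2 * ∫ τ in s..t, evi R b w (eviArg A α lam x τ) := by
  have hT : 0 ≤ T := hs.trans (hst.trans ht)
  have hsub : Set.uIoc s t ⊆ Set.Icc 0 T := by
    rw [Set.uIoc_of_le hst]
    exact Set.Ioc_subset_Icc_self.trans (Set.Icc_subset_Icc hs ht)
  obtain ⟨S, hS⟩ := exists_evi_bound (m := m) hR b w B ρ
  have h1 : Tendsto (fun N => ∫ τ in s..t, evi R b w (eviArg (As N) (αs N) (lams N) (xs N) τ)) atTop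
      (𝓝 (∫ τ in s..t, evi R b w (eviArg A α lam x τ))) := by
    refine intervalIntegral.tendsto_integral_filter_of_dominated_convergence (fun _ => S)
      (Eventually.of_forall fun N => ?_) (Eventually.of_forall fun N => ?_) (by simp) ?_
    · have hcont : ContinuousOn (xs N) (Set.Icc 0 T) := by
        simpa [Set.uIcc_of_le hT] using (hx N).absCont.continuousOn
      exact ((hps N).aestronglyMeasurable_evi hR hcont w).mono_measure
        (Measure.restrict_mono hsub le_rfl)
    · rw [← ae_restrict_iff' measurableSet_uIoc]
      refine ae_restrict_of_ae_restrict_of_subset hsub ?_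
      filter_upwards [(hps N).bound, (hx N).ae_inclusion] with τ hb hi
      obtain ⟨v, y, y', z, hv, hz, a₁, a₂, a₃, a₄, e⟩ := hi
      exact hS _ hb.1 hb.2.1 hb.2.2 a₃
    · rw [← ae_restrict_iff' measurableSet_uIoc]
      refine ae_restrict_of_ae_restrict_of_subset hsub ?_
      filter_upwards [hlim] with τ hτ
      exact ((continuous_evi hR b w).tendsto _).comp hτ
  have h2 : Tendsto (fun N => 2 * ((∫ τ in s..t, evi R b w (eviArg (As N) (αs N) (lams N) (xs N) τ))
      + (t - s) * ((2 * B ^ 2 * G + B ^ 3 * (ρ + ‖w‖)) * ε N))) atTop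
      (𝓝 (2 * ((∫ τ in s..t, evi R b w (eviArg A α lam x τ))
      + (t - s) * ((2 * B ^ 2 * G + B ^ 3 * (ρ + ‖w‖)) * 0)))) :=
    (h1.add ((hε.const_mul _).const_mul _)).const_mul 2
  rw [mul_zero, mul_zero, add_zero] at h2
  have h3 (τ : ℝ) (hτ : τ ∈ Set.Icc 0 T) :
      Tendsto (fun N => ‖xs N τ - w‖ ^ 2) atTop (𝓝 (‖x τ - w‖ ^ 2)) :=
    ((hxlim τ hτ).sub_const w).norm.pow 2
  exact le_of_tendsto_of_tendsto' ((h3 t ⟨hs.trans hst, ht⟩).sub (h3 s ⟨hs, hst.trans ht⟩)) h2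
    fun N => (hx N).norm_sq_sub_le (hps N) hR hne hG w hs hst ht

/-- Absolutely continuous solutions of the evolution variational inequality solve the
differential inclusion. -/
theorem isLimitState_of_norm_sq_sub_le {x0 : Vec n} (hT : 0 ≤ T)
    (hp : IsParam T B A α lam) (hR : Continuous R)
    (hne : ∀ y, (subdiff R y).Nonempty) (hac : AbsolutelyContinuousOnInterval x 0 T)
    (h0 : x 0 = x0)
    (hevi : ∀ w : Vec n, ∀ s t : ℝ, 0 ≤ s → s ≤ t → t ≤ T →
      ‖x t - w‖ ^ 2 - ‖x s - w‖ ^ 2 ≤ 2 * ∫ τ in s..t, evi R b w (eviArg A α lam x τ)) :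
    IsLimitState R T b x0 A α lam x := by
  refine ⟨hac, h0, ?_⟩
  have hcont : ContinuousOn x (Set.Icc 0 T) := by
    simpa [Set.uIcc_of_le hT] using hac.continuousOn
  have hint (w : Vec n) : IntervalIntegrable (fun τ => evi R b w (eviArg A α lam x τ)) volume 0 T :=
    (intervalIntegrable_iff_integrableOn_Icc_of_le hT).2 (hp.integrableOn_evi hR hcont w)
  -- Restricting the test vectors to a countable dense set leaves a single exceptional null set.
  have hae : ∀ᵐ t, ∀ k : ℕ, t ∈ Set.uIcc 0 T → ∀ c ∈ Set.uIcc 0 T,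
      HasDerivAt (fun t => ∫ τ in c..t,
        evi R b (TopologicalSpace.denseSeq (Vec n) k) (eviArg A α lam x τ))
        (evi R b (TopologicalSpace.denseSeq (Vec n) k) (eviArg A α lam x t)) t :=
    ae_all_iff.2 fun k => (hint _).ae_hasDerivAt_integral
  have hd := hac.boundedVariationOn.ae_differentiableAt_of_mem_uIcc
  rw [Set.uIcc_of_le hT] at hd
  have hne0 : ∀ᵐ t : ℝ, t ≠ 0 := by simp [ae_iff]
  have hneT : ∀ᵐ t : ℝ, t ≠ T := by simp [ae_iff]
  filter_upwards [ae_restrict_of_ae hd, ae_restrict_of_ae hae, ae_restrict_of_ae hne0,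
    ae_restrict_of_ae hneT, ae_restrict_mem measurableSet_Icc, hp.bound]
    with t hdt hFt ht0 htT htm hb
  obtain ⟨v, hv⟩ : ∃ v, HasDerivAt x v t := ⟨_, (hdt htm).hasDerivAt⟩
  have htI : t ∈ Set.Ioo 0 T := ⟨lt_of_le_of_ne htm.1 ht0.symm, lt_of_le_of_ne htm.2 htT⟩
  have hdense (k : ℕ) : ⟪x t - TopologicalSpace.denseSeq (Vec n) k, v⟫
      ≤ evi R b (TopologicalSpace.denseSeq (Vec n) k) (eviArg A α lam x t) := by
    set w := TopologicalSpace.denseSeq (Vec n) k with hw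
    have hF := hFt k (by rwa [Set.uIcc_of_le hT]) 0 Set.left_mem_uIcc
    have hder : HasDerivAt (fun s => ‖x s - w‖ ^ 2) _ t := (hv.sub_const w).norm_sq
    -- The integrated inequality says that this function is nondecreasing; its derivative at `t` is
    -- therefore nonnegative.
    have hmono : MonotoneOn (fun t => 2 * (∫ τ in (0 : ℝ)..t, evi R b w (eviArg A α lam x τ))
        - ‖x t - w‖ ^ 2) (Set.Icc 0 T) := by
      intro s hs r hr hsr
      have h1 := hevi w s r hs.1 hsr hr.2
      have h2 := intervalIntegral.integral_add_adjacent_intervals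
        ((hint w).mono_set (by rw [Set.uIcc_of_le hT, Set.uIcc_of_le hs.1]
                               exact Set.Icc_subset_Icc_right hs.2))
        ((hint w).mono_set (c := s) (d := r) (by rw [Set.uIcc_of_le hT, Set.uIcc_of_le hsr]
                                                 exact Set.Icc_subset_Icc hs.1 hr.2))
      simp only
      linarith
    have h3 := ((hF.const_mul 2).sub hder).hasDerivWithinAt.nonneg_of_monotoneOn
      (s := Set.Icc 0 T) (accPt_iff_nhds.2 ?_) hmono
    · linarith
    · intro U hU
      obtain ⟨δ, hδ, hball⟩ := Metric.mem_nhds_iff.1 (inter_mem hU (Ioo_mem_nhds htI.1 htI.2))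
      have hmem := hball (show t + δ / 2 ∈ Metric.ball t δ by
        rw [Metric.mem_ball, Real.dist_eq, add_sub_cancel_left, abs_of_pos (by positivity)]
        linarith)
      exact ⟨t + δ / 2, ⟨hmem.1, Set.Ioo_subset_Icc_self hmem.2⟩, by linarith [hδ]⟩
  -- Both sides are continuous in `w`, so the inequality extends from the dense set.
  have hall (w : Vec n) : ⟪x t - w, v⟫ ≤ evi R b w (eviArg A α lam x t) := by
    refine (TopologicalSpace.denseRange_denseSeq (Vec n)).induction_on w ?_ hdense
    refine isClosed_le (by fun_prop) ?_
    unfold evi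
    fun_prop
  refine ⟨v, hv, ?_⟩
  set ξ := -(v + α t • gradTerm (A t) b (x t)) with hξ
  have hkey (w : Vec n) : ⟪ξ, w - x t⟫ ≤ α t * lam t * (R w - R (x t)) := by
    have h := hall w
    unfold evi eviArg at h
    simp only at h
    have e : ⟪ξ, w - x t⟫ = ⟪x t - w, v⟫ + α t * ⟪gradTerm (A t) b (x t), x t - w⟫ := by
      rw [hξ, inner_neg_left, ← inner_neg_right, neg_sub, inner_add_left, inner_smul_left,
        real_inner_comm]
      simp
    linarith
  -- If the weight is positive, `hkey` divided by it is the subgradient inequality. If it is zero,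
  -- testing with `w = x t + ξ` forces `ξ = 0`, and any subgradient serves.
  have hal : 0 ≤ α t * lam t := mul_nonneg hb.2.1.1 hb.2.2.1
  rcases hal.eq_or_lt with h | h
  · have h1 := hkey (x t + ξ)
    rw [← h, zero_mul, add_sub_cancel_left] at h1
    have h2 : ξ = 0 := inner_self_eq_zero.1 (le_antisymm h1 real_inner_self_nonneg)
    obtain ⟨z, hz⟩ := hne (x t)
    refine ⟨z, hz, ?_⟩
    rw [← h, zero_smul, add_zero]
    exact neg_eq_zero.1 h2
  · refine ⟨(α t * lam t)⁻¹ • ξ, fun w => ?_, ?_⟩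
    · have h1 := mul_le_mul_of_nonneg_left (hkey w) (inv_nonneg.2 h.le)
      rw [inv_mul_cancel_left₀ h.ne'] at h1
      rw [inner_smul_left]
      simp only [conj_trivial]
      linarith
    · rw [smul_inv_smul₀ h.ne', hξ]
      abel

end EvolutionVariationalInequality

/-! ### Solvability of the limit system and convergence of the terminal states. -/

section LimitState

variable {m n : ℕ} {R : Vec n → ℝ} {T B ρ G : ℝ} {b : Vec m} {x0 : Vec n}
  {A : ℝ → Mat m n} {α lam : ℝ → ℝ}

/-- The step function of the averages over the `N` cells of `[0, T]`. -/
def avgStep {X : Type*} [NormedAddCommGroup X] [NormedSpace ℝ X] (T : ℝ) (N : ℕ) (f : ℝ → X) :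
    ℝ → X :=
  stepFun (T / N) (cellAvg (T / N) f)

theorem IsParam.cellAvg_bound (hp : IsParam T B A α lam) (hT : 0 < T) {N k : ℕ} (hk : k < N) :
    ‖cellAvg (T / N) A k‖ ≤ B ∧ (0 ≤ cellAvg (T / N) α k ∧ cellAvg (T / N) α k ≤ B) ∧
      0 ≤ cellAvg (T / N) lam k ∧ cellAvg (T / N) lam k ≤ B := by
  have h1 := cellAvg_mem hT hp.integrable_A (convex_closedBall 0 B) Metric.isClosed_closedBall
    (hp.bound.mono fun t h => by simpa using h.1) hk
  have h2 := cellAvg_mem hT hp.integrable_α (convex_Icc 0 B) isClosed_Icc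
    (hp.bound.mono fun t h => h.2.1) hk
  have h3 := cellAvg_mem hT hp.integrable_lam (convex_Icc 0 B) isClosed_Icc
    (hp.bound.mono fun t h => h.2.2) hk
  exact ⟨by simpa using h1, h2, h3⟩

theorem IsParam.avgStep (hp : IsParam T B A α lam) (hT : 0 < T) {N : ℕ} (hN : 0 < N) :
    IsParam T B (avgStep T N A) (avgStep T N α) (avgStep T N lam) where
  integrable_A := integrableOn_stepFun (by positivity) _ _ _
  integrable_α := integrableOn_stepFun (by positivity) _ _ _
  integrable_lam := integrableOn_stepFun (by positivity) _ _ _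
  bound := by
    have hN' : (0 : ℝ) < N := by exact_mod_cast hN
    filter_upwards [ae_mem_cell hT hN] with t ht
    obtain ⟨k, hk, ht⟩ := ht
    have hh : 0 < T / N := by positivity
    have hIco := Set.Ioo_subset_Ico_self ht
    unfold FBS.avgStep
    rw [stepFun_eq hh _ hIco, stepFun_eq hh _ hIco, stepFun_eq hh _ hIco]
    exact hp.cellAvg_bound hT hk

theorem IsParam.existsUnique_isNetworkState (hp : IsParam T B A α lam) (hT : 0 < T)
    (hR : ConvexOn ℝ Set.univ R) (h0 : (0 : Vec n) ∈ subdiff R 0)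
    (hb : ∀ ρ, ∃ G, 0 ≤ G ∧ SubdiffBound R ρ G) (N : ℕ) :
    ∃! x : Fin (N + 1) → Vec n,
      IsNetworkState R T b x0 (proj T N A) (proj T N α) (proj T N lam) x :=
  FBS.existsUnique_isNetworkState hR h0 hb hT.le
    (fun k => by rw [proj_eq_cellAvg]; exact (hp.cellAvg_bound hT k.2).2.1.1)
    (fun k => by rw [proj_eq_cellAvg]; exact (hp.cellAvg_bound hT k.2).2.2.1)

/-- The radius `ρ` may exceed the a priori bound, so that one `ρ` and one `G` can serve a network
and a limit state together. -/
theorem IsParam.isApproxState_networkInterp (hp : IsParam T B A α lam) (hT : 0 < T) (hB : 0 ≤ B)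
    (h0 : (0 : Vec n) ∈ subdiff R 0) (hρ : stateBound T B ‖b‖ ‖x0‖ ≤ ρ)
    (hG : SubdiffBound R ρ G) {N : ℕ} (hN : 0 < N) {x : Fin (N + 1) → Vec n}
    (hx : IsNetworkState R T b x0 (proj T N A) (proj T N α) (proj T N lam) x) :
    IsApproxState R T b (T / N * speedBound B ‖b‖ ρ G) ρ
        (FBS.avgStep T N A) (FBS.avgStep T N α) (FBS.avgStep T N lam) (networkInterp T x) ∧
      ∀ s t, ‖networkInterp T x t - networkInterp T x s‖ ≤ speedBound B ‖b‖ ρ G * |t - s| := by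
  have eA : proj T N A = fun k : Fin N => cellAvg (T / N) A k := funext (proj_eq_cellAvg A)
  have eα : proj T N α = fun k : Fin N => cellAvg (T / N) α k := funext (proj_eq_cellAvg α)
  have el : proj T N lam = fun k : Fin N => cellAvg (T / N) lam k := funext (proj_eq_cellAvg lam)
  rw [eA, eα, el] at hx
  have hbd (k : Fin N) := hp.cellAvg_bound hT k.2
  have hxρ (i : Fin (N + 1)) : ‖x i‖ ≤ ρ :=
    (hx.norm_le hB h0 hT.le (fun k => (hbd k).1) (fun k => (hbd k).2.1)
      (fun k => (hbd k).2.2) i).trans hρ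
  have hC := hx.norm_succ_sub_le hT.le (fun k => (hbd k).1) (fun k => (hbd k).2.1)
      (fun k => (hbd k).2.2) hxρ hG
  exact ⟨hx.isApproxState hT hN hxρ hC, norm_networkInterp_sub_le hT hN hC⟩

theorem IsLimitState.isApproxState {x : ℝ → Vec n} (hx : IsLimitState R T b x0 A α lam x)
    (hρ : ∀ t ∈ Set.Icc 0 T, ‖x t‖ ≤ ρ) : IsApproxState R T b 0 ρ A α lam x := by
  refine ⟨hx.1, ?_⟩
  filter_upwards [hx.2.2, ae_restrict_mem measurableSet_Icc] with t ht htm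
  obtain ⟨v, hv, z, hz, e⟩ := ht
  exact ⟨v, x t, x t, z, hv, hz, by simp, by simp, hρ t htm, hρ t htm, e⟩

theorem IsLimitState.exists_bound {x : ℝ → Vec n} (hT : 0 ≤ T)
    (hx : IsLimitState R T b x0 A α lam x) : ∃ ρ, 0 ≤ ρ ∧ ∀ t ∈ Set.Icc 0 T, ‖x t‖ ≤ ρ := by
  obtain ⟨ρ, hρ⟩ := hx.1.exists_bound
  rw [Set.uIcc_of_le hT] at hρ
  exact ⟨ρ, (norm_nonneg _).trans (hρ 0 ⟨le_rfl, hT⟩), hρ⟩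

/-- The comparison estimate with equal parameters and `ε₁ = ε₂ = 0` has right-hand side zero. The
radius comes from continuity on a compact interval. -/
theorem IsParam.eqOn_of_isLimitState (hp : IsParam T B A α lam) (hT : 0 < T) (hB : 0 ≤ B)
    (hb : ∀ ρ, ∃ G, 0 ≤ G ∧ SubdiffBound R ρ G) {x x' : ℝ → Vec n}
    (hx : IsLimitState R T b x0 A α lam x) (hx' : IsLimitState R T b x0 A α lam x') :
    Set.EqOn x x' (Set.Icc 0 T) := by
  intro t ht
  obtain ⟨ρ₁, hρ₁, h₁⟩ := hx.exists_bound hT.le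
  obtain ⟨ρ₂, hρ₂, h₂⟩ := hx'.exists_bound hT.le
  set ρ := max ρ₁ ρ₂ with hρ
  obtain ⟨G, hG0, hG⟩ := hb ρ
  have h := norm_sub_sq_le hT.le hG
    (compareConst_nonneg hB (norm_nonneg b) (hρ₁.trans (le_max_left _ _)) hG0) (by simp) hp hp
    (hx.isApproxState fun t ht => (h₁ t ht).trans (le_max_left _ _))
    (hx'.isApproxState fun t ht => (h₂ t ht).trans (le_max_right _ _))
    (hx.2.1.trans hx'.2.1.symm) ht
  have hd : paramDist A A α α lam lam = 0 := by
    funext s; simp [paramDist]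
  simp only [hd, Pi.zero_apply, integral_zero, add_zero, zero_mul, mul_zero] at h
  have h' : ‖x t - x' t‖ = 0 := by
    have := pow_eq_zero_iff two_ne_zero |>.1 (le_antisymm h (sq_nonneg _))
    exact this
  exact sub_eq_zero.1 (norm_eq_zero.1 h')

theorem tendsto_integral_paramDist_avgStep (hT : 0 < T) {As : ℕ → ℝ → Mat m n}
    {αs lams : ℕ → ℝ → ℝ} (hps : ∀ N, 1 ≤ N → IsParam T B (As N) (αs N) (lams N))
    (hp : IsParam T B A α lam)
    (hA : Tendsto (fun N => ∫ t in Set.Icc 0 T, ‖As N t - A t‖) atTop (𝓝 0))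
    (hα : Tendsto (fun N => ∫ t in Set.Icc 0 T, ‖αs N t - α t‖) atTop (𝓝 0))
    (hlam : Tendsto (fun N => ∫ t in Set.Icc 0 T, ‖lams N t - lam t‖) atTop (𝓝 0)) :
    Tendsto (fun N : ℕ => ∫ t in Set.Icc 0 T, paramDist (FBS.avgStep T N (As N)) A
      (FBS.avgStep T N (αs N)) α (FBS.avgStep T N (lams N)) lam t) atTop (𝓝 0) := by
  have h1 := tendsto_integral_norm_stepFun_sub hT (fun N hN => (hps N hN).integrable_A)
    hp.integrable_A (hp.bound.mono fun t h => h.1) hA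
  have h2 := tendsto_integral_norm_stepFun_sub (B := B) hT (fun N hN => (hps N hN).integrable_α)
    hp.integrable_α (hp.bound.mono fun t h => by
      rw [Real.norm_of_nonneg h.2.1.1]; exact h.2.1.2) hα
  have h3 := tendsto_integral_norm_stepFun_sub (B := B) hT (fun N hN => (hps N hN).integrable_lam)
    hp.integrable_lam (hp.bound.mono fun t h => by
      rw [Real.norm_of_nonneg h.2.2.1]; exact h.2.2.2) hlam
  have h4 := (h1.add h2).add h3
  rw [add_zero, add_zero] at h4
  refine h4.congr' ?_
  filter_upwards [eventually_ge_atTop 1] with N hN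
  have hq := (hps N hN).avgStep hT hN
  have i1 : IntegrableOn (fun t => ‖FBS.avgStep T N (As N) t - A t‖) (Set.Icc 0 T) :=
    (hq.integrable_A.sub hp.integrable_A).norm
  have i2 : IntegrableOn (fun t => ‖FBS.avgStep T N (αs N) t - α t‖) (Set.Icc 0 T) :=
    (hq.integrable_α.sub hp.integrable_α).norm
  have i3 : IntegrableOn (fun t => ‖FBS.avgStep T N (lams N) t - lam t‖) (Set.Icc 0 T) :=
    (hq.integrable_lam.sub hp.integrable_lam).norm
  have e1 := integral_add (i1.add i2) i3
  have e2 := integral_add i1 i2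
  simp only [Pi.add_apply] at e1 e2
  unfold paramDist
  simp only [← Real.norm_eq_abs]
  rw [e1, e2]
  rfl

theorem IsParam.integral_paramDist_le {A₁ A₂ : ℝ → Mat m n} {α₁ α₂ lam₁ lam₂ : ℝ → ℝ}
    (hp₁ : IsParam T B A₁ α₁ lam₁) (hp₂ : IsParam T B A₂ α₂ lam₂) (hp : IsParam T B A α lam) :
    ∫ t in Set.Icc 0 T, paramDist A₁ A₂ α₁ α₂ lam₁ lam₂ t
      ≤ (∫ t in Set.Icc 0 T, paramDist A₁ A α₁ α lam₁ lam t)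
        + ∫ t in Set.Icc 0 T, paramDist A₂ A α₂ α lam₂ lam t := by
  rw [← integral_add (hp₁.integrableOn_paramDist hp) (hp₂.integrableOn_paramDist hp)]
  refine integral_mono (hp₁.integrableOn_paramDist hp₂)
    ((hp₁.integrableOn_paramDist hp).add (hp₂.integrableOn_paramDist hp)) fun t => ?_
  unfold paramDist
  simp only
  have h1 := norm_sub_le_norm_sub_add_norm_sub (A₁ t) (A t) (A₂ t)
  have h2 := abs_sub_le (α₁ t) (α t) (α₂ t)
  have h3 := abs_sub_le (lam₁ t) (lam t) (lam₂ t)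
  rw [norm_sub_rev (A t)] at h1
  rw [abs_sub_comm (α t)] at h2
  rw [abs_sub_comm (lam t)] at h3
  linarith

/-- The interpolations of the networks with averaged parameters form a Cauchy sequence at every
time; their limit inherits the Lipschitz constant `C` and the evolution variational inequality. -/
theorem IsParam.exists_isLimitState (hp : IsParam T B A α lam) (hT : 0 < T) (hB : 0 ≤ B)
    (hR : ConvexOn ℝ Set.univ R) (h0 : (0 : Vec n) ∈ subdiff R 0)
    (hb : ∀ ρ, ∃ G, 0 ≤ G ∧ SubdiffBound R ρ G) :
    ∃ x : ℝ → Vec n, IsLimitState R T b x0 A α lam x := by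
  set ρ := stateBound T B ‖b‖ ‖x0‖ with hρ
  have hρ0 : 0 ≤ ρ := by rw [hρ]; unfold stateBound; positivity
  obtain ⟨G, hG0, hG⟩ := hb ρ
  set C := speedBound B ‖b‖ ρ G with hC
  have hC0 : 0 ≤ C := by rw [hC]; unfold speedBound; positivity
  set K := compareConst B ‖b‖ ρ G with hKdef
  have hK : 0 ≤ K := compareConst_nonneg hB (norm_nonneg _) hρ0 hG0
  -- The index is shifted to `N + 1` to avoid the network without layers.
  choose x hx _ using fun N : ℕ =>
    hp.existsUnique_isNetworkState (b := b) (x0 := x0) hT hR h0 hb (N + 1)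
  have hpN (N : ℕ) := hp.avgStep hT (Nat.succ_pos N)
  set X : ℕ → ℝ → Vec n := fun N => networkInterp T (x N) with hX
  have hXspec (N : ℕ) := hp.isApproxState_networkInterp hT hB h0 le_rfl hG (Nat.succ_pos N) (hx N)
  have hX0 (N : ℕ) : X N 0 = x0 := (networkInterp_zero _).trans (hx N).1
  set ε : ℕ → ℝ := fun N => T / ((N + 1 : ℕ) : ℝ) * C with hε
  have hε0 (N : ℕ) : 0 ≤ ε N := by rw [hε]; positivity
  have hεlim : Tendsto ε atTop (𝓝 0) := by
    have := ((tendsto_const_div_atTop_nhds_zero_nat T).comp (tendsto_add_atTop_nat 1)).mul_const C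
    rw [zero_mul] at this
    exact this
  set δ : ℕ → ℝ := fun N => ε N * T + ∫ t in Set.Icc 0 T, paramDist (FBS.avgStep T (N + 1) A) A
    (FBS.avgStep T (N + 1) α) α (FBS.avgStep T (N + 1) lam) lam t with hδ
  have hδlim : Tendsto δ atTop (𝓝 0) := by
    have h1 := (tendsto_integral_paramDist_avgStep hT (As := fun _ => A) (αs := fun _ => α)
      (lams := fun _ => lam) (fun _ _ => hp) hp (by simp) (by simp) (by simp)).comp
      (tendsto_add_atTop_nat 1)
    have h2 := (hεlim.mul_const T).add h1
    rw [zero_mul, add_zero] at h2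
    exact h2
  -- The distance between two averaged parameters is split through the original one, so each `δ`
  -- depends on a single index.
  have hcomp (N M : ℕ) (t : ℝ) (ht : t ∈ Set.Icc 0 T) :
      ‖X N t - X M t‖ ^ 2 ≤ K * (δ N + δ M) := by
    refine (norm_sub_sq_le hT.le hG hK (add_nonneg (hε0 N) (hε0 M)) (hpN N) (hpN M)
      (hXspec N).1 (hXspec M).1 ((hX0 N).trans (hX0 M).symm) ht).trans ?_
    refine mul_le_mul_of_nonneg_left ?_ hK
    have := (hpN N).integral_paramDist_le (hpN M) hp
    rw [hδ]
    simp only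
    linarith
  have hcauchy (t : ℝ) (ht : t ∈ Set.Icc 0 T) : CauchySeq fun N => X N t := by
    rw [Metric.cauchySeq_iff]
    intro η hη
    have h1 : Tendsto (fun N => K * δ N) atTop (𝓝 0) := by
      simpa using hδlim.const_mul K
    obtain ⟨N₀, hN₀⟩ := eventually_atTop.1 (h1.eventually_lt_const (by positivity : 0 < η ^ 2 / 2))
    refine ⟨N₀, fun N hN M hM => ?_⟩
    rw [dist_eq_norm]
    refine lt_of_pow_lt_pow_left₀ 2 hη.le ((hcomp N M t ht).trans_lt ?_)
    linarith [hN₀ N hN, hN₀ M hM]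
  -- Outside `[0, T]` the value of the limit is irrelevant and is set to `0`.
  have hex (t : ℝ) : ∃ y, t ∈ Set.Icc 0 T → Tendsto (fun N => X N t) atTop (𝓝 y) := by
    by_cases ht : t ∈ Set.Icc 0 T
    · obtain ⟨y, hy⟩ := cauchySeq_tendsto_of_complete (hcauchy t ht)
      exact ⟨y, fun _ => hy⟩
    · exact ⟨0, fun h => absurd h ht⟩
  choose Y hY using hex
  have hYac : AbsolutelyContinuousOnInterval Y 0 T := by
    refine LipschitzOnWith.absolutelyContinuousOnInterval (K := C.toNNReal)
      (LipschitzOnWith.of_dist_le_mul fun t ht s hs => ?_)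
    rw [Set.uIcc_of_le hT.le] at ht hs
    refine le_of_tendsto ((hY t ht).dist (hY s hs)) (Eventually.of_forall fun N => ?_)
    rw [dist_eq_norm, dist_eq_norm, Real.norm_eq_abs, Real.coe_toNNReal C hC0]
    exact (hXspec N).2 s t
  have hY0 : Y 0 = x0 := by
    have h1 := hY 0 ⟨le_rfl, hT.le⟩
    simp only [hX0] at h1
    exact tendsto_nhds_unique h1 tendsto_const_nhds
  have hne := subdiff_nonempty hR h0 hb
  have hRc : Continuous R := hR.locallyLipschitz.continuous
  refine ⟨Y, isLimitState_of_norm_sq_sub_le hT.le hp hRc hne hYac hY0 fun w s t hs hst ht => ?_⟩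
  refine norm_sq_sub_le_of_tendsto (fun N => (hXspec N).1) hpN hRc hne hG hεlim ?_ hY w hs hst ht
  filter_upwards [ae_tendsto_stepFun_cellAvg hp.integrable_A,
    ae_tendsto_stepFun_cellAvg hp.integrable_α, ae_tendsto_stepFun_cellAvg hp.integrable_lam,
    ae_restrict_mem measurableSet_Icc] with t h1 h2 h3 htm
  exact (h1.comp (tendsto_add_atTop_nat 1)).prodMk_nhds
    ((h2.comp (tendsto_add_atTop_nat 1)).prodMk_nhds
      ((h3.comp (tendsto_add_atTop_nat 1)).prodMk_nhds (hY t htm)))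

/-- The terminal states of the networks converge to the terminal state of the limit system. -/
theorem tendsto_networkState_last (hT : 0 < T) (hB : 0 ≤ B)
    (hR : ConvexOn ℝ Set.univ R) (h0 : (0 : Vec n) ∈ subdiff R 0)
    (hb : ∀ ρ, ∃ G, 0 ≤ G ∧ SubdiffBound R ρ G) {As : ℕ → ℝ → Mat m n}
    {αs lams : ℕ → ℝ → ℝ} (hps : ∀ N, 1 ≤ N → IsParam T B (As N) (αs N) (lams N))
    (hp : IsParam T B A α lam)
    (hA : Tendsto (fun N => ∫ t in Set.Icc 0 T, ‖As N t - A t‖) atTop (𝓝 0))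
    (hα : Tendsto (fun N => ∫ t in Set.Icc 0 T, ‖αs N t - α t‖) atTop (𝓝 0))
    (hlam : Tendsto (fun N => ∫ t in Set.Icc 0 T, ‖lams N t - lam t‖) atTop (𝓝 0)) :
    Tendsto (fun N : ℕ => networkState R T b x0 (proj T N (As N)) (proj T N (αs N))
      (proj T N (lams N)) (Fin.last N)) atTop (𝓝 (limitState R T b x0 A α lam T)) := by
  have hlimit : IsLimitState R T b x0 A α lam (limitState R T b x0 A α lam) :=
    Classical.epsilon_spec (hp.exists_isLimitState hT hB hR h0 hb)
  obtain ⟨ρ₁, hρ₁, h₁⟩ := hlimit.exists_bound hT.le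
  -- One radius for the networks and for the limit state, as the comparison requires.
  set ρ := max (stateBound T B ‖b‖ ‖x0‖) ρ₁ with hρ
  have hρ0 : 0 ≤ ρ := hρ₁.trans (le_max_right _ _)
  obtain ⟨G, hG0, hG⟩ := hb ρ
  set C := speedBound B ‖b‖ ρ G with hC
  have hC0 : 0 ≤ C := by rw [hC]; unfold speedBound; positivity
  set K := compareConst B ‖b‖ ρ G with hKdef
  have hK : 0 ≤ K := compareConst_nonneg hB (norm_nonneg _) hρ0 hG0
  -- The summand `0` is the error of the exact solution.
  have hεlim : Tendsto (fun N : ℕ => T / N * C + 0) atTop (𝓝 0) := by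
    have := ((tendsto_const_div_atTop_nhds_zero_nat T).mul_const C).add_const 0
    rwa [zero_mul, add_zero] at this
  have hlim := ((hεlim.mul_const T).add
    (tendsto_integral_paramDist_avgStep hT hps hp hA hα hlam)).const_mul K
  rw [zero_mul, add_zero, mul_zero] at hlim
  rw [tendsto_iff_norm_sub_tendsto_zero]
  have hsq := squeeze_zero' (f := fun N : ℕ => ‖networkState R T b x0 (proj T N (As N))
    (proj T N (αs N)) (proj T N (lams N)) (Fin.last N) - limitState R T b x0 A α lam T‖ ^ 2)
    (Eventually.of_forall fun N => by positivity) (by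
      filter_upwards [eventually_ge_atTop 1] with N hN
      have hx : IsNetworkState R T b x0 (proj T N (As N)) (proj T N (αs N)) (proj T N (lams N))
          (networkState R T b x0 (proj T N (As N)) (proj T N (αs N)) (proj T N (lams N))) :=
        Classical.epsilon_spec ((hps N hN).existsUnique_isNetworkState hT hR h0 hb N).exists
      have hap := (hps N hN).isApproxState_networkInterp hT hB h0 (le_max_left _ _) hG hN hx
      have h := norm_sub_sq_le hT.le hG hK (by positivity) ((hps N hN).avgStep hT hN) hp hap.1
        (hlimit.isApproxState fun t ht => (h₁ t ht).trans (le_max_right _ _))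
        ((networkInterp_zero _).trans (hx.1.trans hlimit.2.1.symm)) (t := T) ⟨hT.le, le_rfl⟩
      rwa [networkInterp_last hT hN] at h) hlim
  have hsqrt := hsq.sqrt
  simpa using hsqrt

end LimitState

/-! ### Convergence of the regularizers. -/

section Regularizers

theorem abs_rpow_sub_rpow_le {p B x y : ℝ} (hp : 1 ≤ p) (hx : x ∈ Set.Icc 0 B)
    (hy : y ∈ Set.Icc 0 B) : |x ^ p - y ^ p| ≤ p * B ^ (p - 1) * |x - y| := by
  refine Convex.norm_image_sub_le_of_norm_hasDerivWithin_le (f := fun x : ℝ => x ^ p)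
    (fun z _ => (Real.hasDerivAt_rpow_const (Or.inr hp)).hasDerivWithinAt) (fun z hz => ?_)
    (convex_Icc 0 B) hy hx
  have hz0 : 0 ≤ z ^ (p - 1) := Real.rpow_nonneg hz.1 _
  rw [Real.norm_of_nonneg (by positivity)]
  exact mul_le_mul_of_nonneg_left (Real.rpow_le_rpow hz.1 hz.2 (by linarith)) (by linarith)

variable {X : Type*} [NormedAddCommGroup X]

theorem integrableOn_norm_rpow {p T B : ℝ} (hp : 1 ≤ p) {f : ℝ → X}
    (hf : IntegrableOn f (Set.Icc 0 T))
    (hfB : ∀ᵐ t ∂(volume.restrict (Set.Icc 0 T)), ‖f t‖ ≤ B) :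
    IntegrableOn (fun t => ‖f t‖ ^ p) (Set.Icc 0 T) := by
  refine Integrable.of_bound
    (hf.aestronglyMeasurable.norm.aemeasurable.pow_const p).aestronglyMeasurable (B ^ p) (hfB.mono fun t ht => ?_)
  rw [Real.norm_of_nonneg (Real.rpow_nonneg (norm_nonneg _) _)]
  exact Real.rpow_le_rpow (norm_nonneg _) ht (by linarith)

/-- The discrete mean equals `(1/T) ∫ ‖avgStep‖ ^ p`. As `r ↦ r ^ p` has Lipschitz constant `p B ^
(p - 1)` on `[0, B]`, the bound on the functions turns `L¹` convergence into convergence of these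
integrals. Of `ψ` only continuity is needed. -/
theorem tendsto_discreteReg [NormedSpace ℝ X] [CompleteSpace X] {p T B : ℝ} (hp : 1 ≤ p)
    (hT : 0 < T) {ψ : ℝ → ℝ} (hψ : Continuous ψ) {f : ℕ → ℝ → X} {g : ℝ → X}
    (hf : ∀ N, 1 ≤ N → IntegrableOn (f N) (Set.Icc 0 T))
    (hfB : ∀ N, 1 ≤ N → ∀ᵐ t ∂(volume.restrict (Set.Icc 0 T)), ‖f N t‖ ≤ B)
    (hg : IntegrableOn g (Set.Icc 0 T))
    (hgB : ∀ᵐ t ∂(volume.restrict (Set.Icc 0 T)), ‖g t‖ ≤ B)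
    (hfg : Tendsto (fun N => ∫ t in Set.Icc 0 T, ‖f N t - g t‖) atTop (𝓝 0)) :
    Tendsto (fun N : ℕ => discreteReg ψ p (proj T N (f N))) atTop (𝓝 (contReg ψ p T g)) := by
  unfold discreteReg contReg
  refine (hψ.tendsto _).comp ?_
  have hstep := tendsto_integral_norm_stepFun_sub hT hf hg hgB hfg
  have hsum (N : ℕ) (hN : 0 < N) : 1 / N * ∑ k, ‖proj T N (f N) k‖ ^ p
      = 1 / T * ∫ t in Set.Icc 0 T, ‖avgStep T N (f N) t‖ ^ p := by
    have hN' : (0 : ℝ) < N := by exact_mod_cast hN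
    have h1 := integral_stepFun hT hN fun k => ‖cellAvg (T / N) (f N) k‖ ^ p
    simp only [proj_eq_cellAvg]
    rw [Fin.sum_univ_eq_sum_range fun k => ‖cellAvg (T / N) (f N) k‖ ^ p]
    calc 1 / (N : ℝ) * ∑ k ∈ Finset.range N, ‖cellAvg (T / N) (f N) k‖ ^ p
        = 1 / T * ((T / N) • ∑ k ∈ Finset.range N, ‖cellAvg (T / N) (f N) k‖ ^ p) := by
          rw [smul_eq_mul]; field_simp
      _ = _ := by rw [← h1]; rfl
  suffices Tendsto (fun N : ℕ => ∫ t in Set.Icc 0 T, ‖avgStep T N (f N) t‖ ^ p) atTop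
      (𝓝 (∫ t in Set.Icc 0 T, ‖g t‖ ^ p)) by
    refine (this.const_mul (1 / T)).congr' ?_
    filter_upwards [eventually_gt_atTop 0] with N hN
    exact (hsum N hN).symm
  rw [tendsto_iff_norm_sub_tendsto_zero]
  have hlim := hstep.const_mul (p * B ^ (p - 1))
  rw [mul_zero] at hlim
  refine squeeze_zero' (Eventually.of_forall fun N => norm_nonneg _) ?_ hlim
  filter_upwards [eventually_ge_atTop 1] with N hN
  have hsB : ∀ᵐ t ∂(volume.restrict (Set.Icc 0 T)), ‖avgStep T N (f N) t‖ ≤ B := by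
    have := ae_stepFun_cellAvg_mem hT (hf N hN) (convex_closedBall 0 B) Metric.isClosed_closedBall
      (by simpa using hfB N hN) hN
    exact this.mono fun t ht => mem_closedBall_zero_iff.1 ht
  have hsi : IntegrableOn (avgStep T N (f N)) (Set.Icc 0 T) :=
    integrableOn_stepFun (by positivity) _ _ _
  rw [← integral_sub (integrableOn_norm_rpow hp hsi hsB) (integrableOn_norm_rpow hp hg hgB),
    ← integral_const_mul]
  refine (norm_integral_le_integral_norm _).trans (integral_mono_ae ?_ ?_ ?_)
  · exact ((integrableOn_norm_rpow hp hsi hsB).sub (integrableOn_norm_rpow hp hg hgB)).norm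
  · exact (hsi.sub hg).norm.const_mul _
  · filter_upwards [hsB, hgB] with t h1 h2
    rw [Real.norm_eq_abs]
    have hB : 0 ≤ B := (norm_nonneg _).trans h2
    refine (abs_rpow_sub_rpow_le hp ⟨norm_nonneg _, h1⟩ ⟨norm_nonneg _, h2⟩).trans ?_
    have := Real.rpow_nonneg hB (p - 1)
    exact mul_le_mul_of_nonneg_left (abs_norm_sub_norm_le _ _) (by positivity)

end Regularizers

/-! ### From bounded sets of controls to integrable, bounded parameters. -/

section Controls

variable {m n : ℕ} {T : ℝ}

theorem norm_param_eq (q : Param m n) : ‖q‖ = ‖q.fst‖ + (‖q.snd.fst‖ + ‖q.snd.snd‖) := by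
  rw [WithLp.prod_norm_eq_of_L1, WithLp.prod_norm_eq_of_L1]

theorem Control.ae_norm_le (u : Control m n T) :
    ∀ᵐ t ∂(volume.restrict (Set.Icc 0 T)), ‖u t‖ ≤ ‖u‖ := by
  filter_upwards [ae_le_eLpNormEssSup (f := u) (μ := volume.restrict (Set.Icc 0 T))] with t ht
  rw [Lp.norm_def, eLpNorm_exponent_top, ← toReal_enorm]
  refine ENNReal.toReal_mono ?_ ht
  rw [← eLpNorm_exponent_top]
  exact Lp.eLpNorm_ne_top u

theorem Control.integrable (u : Control m n T) : IntegrableOn u (Set.Icc 0 T) :=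
  Integrable.of_bound (Lp.aestronglyMeasurable u) ‖u‖ u.ae_norm_le

theorem Control.isParam (u : Control m n T) {B : ℝ} (hB : ‖u‖ ≤ B)
    (h : ∀ᵐ t ∂(volume.restrict (Set.Icc 0 T)), 0 ≤ u.α t ∧ 0 ≤ u.lam t) :
    IsParam T B u.A u.α u.lam := by
  have hm := Lp.aestronglyMeasurable u
  have hb : ∀ᵐ t ∂(volume.restrict (Set.Icc 0 T)),
      ‖u.A t‖ ≤ B ∧ ‖u.α t‖ ≤ B ∧ ‖u.lam t‖ ≤ B := by
    filter_upwards [u.ae_norm_le] with t ht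
    have h1 := ht.trans hB
    rw [norm_param_eq] at h1
    have h2 := norm_nonneg (u t).fst
    have h3 := norm_nonneg (u t).snd.fst
    have h4 := norm_nonneg (u t).snd.snd
    exact ⟨(by linarith : ‖(u t).fst‖ ≤ B), (by linarith : ‖(u t).snd.fst‖ ≤ B),
      (by linarith : ‖(u t).snd.snd‖ ≤ B)⟩
  have c1 : Continuous fun q : Param m n => q.fst := by fun_prop
  have c2 : Continuous fun q : Param m n => q.snd.fst := by fun_prop
  have c3 : Continuous fun q : Param m n => q.snd.snd := by fun_prop
  refine ⟨Integrable.of_bound (c1.comp_aestronglyMeasurable hm) B (hb.mono fun t h => h.1),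
    Integrable.of_bound (c2.comp_aestronglyMeasurable hm) B (hb.mono fun t h => h.2.1),
    Integrable.of_bound (c3.comp_aestronglyMeasurable hm) B (hb.mono fun t h => h.2.2), ?_⟩
  filter_upwards [hb, h] with t h1 h2
  exact ⟨h1.1, ⟨h2.1, (le_abs_self _).trans h1.2.1⟩, h2.2, (le_abs_self _).trans h1.2.2⟩

/-- On a finite measure space the `L¹` norm is at most a constant times the `L^p` norm for `p ≥ 1`;
the constant `c` is a finite power of the total mass. -/
theorem tendsto_integral_norm_sub_of_eLpNorm {p : ℝ} (hp : 1 ≤ p) {u : ℕ → Control m n T}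
    {v : Control m n T}
    (h : Tendsto (fun N : ℕ => eLpNorm (fun t => u N t - v t) (ENNReal.ofReal p)
      (volume.restrict (Set.Icc 0 T))) atTop (𝓝 0)) :
    Tendsto (fun N => ∫ t in Set.Icc 0 T, ‖u N t - v t‖) atTop (𝓝 0) := by
  have hm (N : ℕ) : AEStronglyMeasurable (fun t => u N t - v t) (volume.restrict (Set.Icc 0 T)) :=
    (Lp.aestronglyMeasurable (u N)).sub (Lp.aestronglyMeasurable v)
  set μ := volume.restrict (Set.Icc (0 : ℝ) T) with hμ
  set c := μ Set.univ ^ (1 / (1 : ℝ≥0∞).toReal - 1 / (ENNReal.ofReal p).toReal) with hc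
  have hctop : c ≠ ∞ := by
    refine ENNReal.rpow_ne_top_of_nonneg ?_ (measure_ne_top _ _)
    rw [ENNReal.toReal_ofReal (by linarith), ENNReal.toReal_one, sub_nonneg]
    exact one_div_le_one_div_of_le one_pos hp
  have h1 : Tendsto (fun N : ℕ => eLpNorm (fun t => u N t - v t) 1 μ) atTop (𝓝 0) := by
    have h2 := ENNReal.Tendsto.mul_const h (Or.inr hctop)
    rw [zero_mul] at h2
    refine tendsto_of_tendsto_of_tendsto_of_le_of_le tendsto_const_nhds h2 (fun _ => zero_le)
      fun N => eLpNorm_le_eLpNorm_mul_rpow_measure_univ ?_ (hm N)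
    rw [← ENNReal.ofReal_one]
    exact ENNReal.ofReal_le_ofReal hp
  have h3 := (ENNReal.tendsto_toReal ENNReal.zero_ne_top).comp h1
  refine h3.congr fun N => ?_
  rw [integral_norm_eq_lintegral_enorm (hm N), ← eLpNorm_one_eq_lintegral_enorm]
  rfl

theorem tendsto_integral_norm_comp_sub {Y : Type*} [NormedAddCommGroup Y]
    {u : ℕ → Control m n T} {v : Control m n T} (g : Param m n → Y)
    (hg : ∀ q q', ‖g q - g q'‖ ≤ ‖q - q'‖)
    (h : Tendsto (fun N => ∫ t in Set.Icc 0 T, ‖u N t - v t‖) atTop (𝓝 0)) :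
    Tendsto (fun N => ∫ t in Set.Icc 0 T, ‖g (u N t) - g (v t)‖) atTop (𝓝 0) := by
  refine squeeze_zero (fun N => integral_nonneg fun t => norm_nonneg _) (fun N => ?_) h
  exact integral_mono_of_nonneg (Eventually.of_forall fun t => norm_nonneg _)
    ((u N).integrable.sub v.integrable).norm (Eventually.of_forall fun t => hg _ _)

end Controls

end FBS

end

/-! ### Well-posedness and convergence of the objectives. -/

theorem mainTheorem1 {m n : ℕ} (R : FBS.Vec n → ℝ) (L : FBS.Vec n → FBS.Vec n → ℝ) (ψ : ℝ → ℝ)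
    (p T β₁ β₂ β₃ : ℝ) (b : FBS.Vec m) (x0 y : FBS.Vec n)
    (hp : 1 ≤ p) (hT : 0 < T) (hβ₁ : 0 ≤ β₁) (hβ₂ : 0 ≤ β₂) (hβ₃ : 0 ≤ β₃)
    (hA1 : ConvexOn ℝ Set.univ R)
    (hA2 : (0 : FBS.Vec n) ∈ FBS.subdiff R 0)
    (hA3 : ∃ M : ℝ, 0 < M ∧ ∀ x : FBS.Vec n,
      (∀ z ∈ FBS.subdiff R x, ‖z‖ ≤ M * ‖x‖) ∨ (∀ z ∈ FBS.subdiff R x, ‖z‖ ≤ M))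
    (hA4 : Continuous (fun q : FBS.Vec n × FBS.Vec n => L q.1 q.2) ∧ ∀ x w, 0 ≤ L x w)
    (hA5 : LocallyLipschitz ψ ∧ ∀ r, 0 ≤ ψ r)
    (F : Set (FBS.Control m n T)) (hFne : F.Nonempty) (hFb : Bornology.IsBounded F)
    (hFnonneg : ∀ u ∈ F, ∀ᵐ t ∂(volume.restrict (Set.Icc 0 T)), 0 ≤ u.α t ∧ 0 ≤ u.lam t) :
    -- both state systems are uniquely solvable, so that the objectives are well defined
    (∀ u ∈ F,
      (∀ N : ℕ, 1 ≤ N → ∃! x : Fin (N + 1) → FBS.Vec n,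
        FBS.IsNetworkState R T b x0 (FBS.proj T N u.A) (FBS.proj T N u.α) (FBS.proj T N u.lam) x) ∧
      (∃ x : ℝ → FBS.Vec n, FBS.IsLimitState R T b x0 u.A u.α u.lam x) ∧
      (∀ x x' : ℝ → FBS.Vec n, FBS.IsLimitState R T b x0 u.A u.α u.lam x →
        FBS.IsLimitState R T b x0 u.A u.α u.lam x' → Set.EqOn x x' (Set.Icc 0 T))) ∧
    -- convergence of the objectives
    ∀ v ∈ F, ∀ u : ℕ → FBS.Control m n T, (∀ N : ℕ, 1 ≤ N → u N ∈ F) →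
      Tendsto (fun N : ℕ => eLpNorm (fun t => u N t - v t) (ENNReal.ofReal p)
        (volume.restrict (Set.Icc 0 T))) atTop (𝓝 0) →
      Tendsto (fun N : ℕ => FBS.discreteObjective R L ψ p T β₁ β₂ β₃ b x0 y
          (FBS.proj T N (u N).A) (FBS.proj T N (u N).α) (FBS.proj T N (u N).lam)) atTop
        (𝓝 (FBS.contObjective R L ψ p T β₁ β₂ β₃ b x0 y v.A v.α v.lam)) := by
  -- One bound for all of `F`, so every constant below is uniform along the sequence.
  obtain ⟨B, hB0, hB⟩ := hFb.exists_pos_norm_le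
  have hb := FBS.exists_subdiffBound hA3
  have hpar (u : FBS.Control m n T) (hu : u ∈ F) : FBS.IsParam T B u.A u.α u.lam :=
    u.isParam (hB u hu) (hFnonneg u hu)
  refine ⟨fun u hu => ⟨fun N _ => (hpar u hu).existsUnique_isNetworkState hT hA1 hA2 hb N,
    (hpar u hu).exists_isLimitState hT hB0.le hA1 hA2 hb,
    fun x x' hx hx' => (hpar u hu).eqOn_of_isLimitState hT hB0.le hb hx hx'⟩,
    fun v hv u hu huv => ?_⟩
  have hps (N : ℕ) (hN : 1 ≤ N) := hpar (u N) (hu N hN)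
  have hp' := hpar v hv
  have hL1 := FBS.tendsto_integral_norm_sub_of_eLpNorm hp huv
  -- In the norm `‖U‖ + |η| + |ζ|` each coordinate projection is 1-Lipschitz, so the components
  -- converge separately in `L¹`.
  have hA : Tendsto (fun N => ∫ t in Set.Icc 0 T, ‖(u N).A t - v.A t‖) atTop (𝓝 0) :=
    FBS.tendsto_integral_norm_comp_sub (fun q => q.fst) (fun q q' => by
      rw [FBS.norm_param_eq (q - q')]
      exact le_add_of_nonneg_right (by positivity)) hL1
  have hα : Tendsto (fun N => ∫ t in Set.Icc 0 T, ‖(u N).α t - v.α t‖) atTop (𝓝 0) :=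
    FBS.tendsto_integral_norm_comp_sub (fun q => q.snd.fst) (fun q q' => by
      rw [FBS.norm_param_eq (q - q')]
      exact (le_add_of_nonneg_right (norm_nonneg _)).trans
        (le_add_of_nonneg_left (norm_nonneg _))) hL1
  have hlam : Tendsto (fun N => ∫ t in Set.Icc 0 T, ‖(u N).lam t - v.lam t‖) atTop (𝓝 0) :=
    FBS.tendsto_integral_norm_comp_sub (fun q => q.snd.snd) (fun q q' => by
      rw [FBS.norm_param_eq (q - q')]
      exact (le_add_of_nonneg_left (norm_nonneg _)).trans
        (le_add_of_nonneg_left (norm_nonneg _))) hL1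
  have hψ := hA5.1.continuous
  have hx := FBS.tendsto_networkState_last (b := b) (x0 := x0) hT hB0.le hA1 hA2 hb hps hp'
    hA hα hlam
  have hcont : Continuous fun w => L w y := hA4.1.comp (continuous_id.prodMk continuous_const)
  have r₁ := FBS.tendsto_discreteReg hp hT hψ (fun N hN => (hps N hN).integrable_A)
    (fun N hN => (hps N hN).bound.mono fun t h => h.1) hp'.integrable_A
    (hp'.bound.mono fun t h => h.1) hA
  have r₂ := FBS.tendsto_discreteReg (B := B) hp hT hψ (fun N hN => (hps N hN).integrable_α)
    (fun N hN => (hps N hN).bound.mono fun t h => by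
      rw [Real.norm_of_nonneg h.2.1.1]; exact h.2.1.2) hp'.integrable_α
    (hp'.bound.mono fun t h => by rw [Real.norm_of_nonneg h.2.1.1]; exact h.2.1.2) hα
  have r₃ := FBS.tendsto_discreteReg (B := B) hp hT hψ (fun N hN => (hps N hN).integrable_lam)
    (fun N hN => (hps N hN).bound.mono fun t h => by
      rw [Real.norm_of_nonneg h.2.2.1]; exact h.2.2.2) hp'.integrable_lam
    (hp'.bound.mono fun t h => by rw [Real.norm_of_nonneg h.2.2.1]; exact h.2.2.2) hlam
  exact ((((hcont.tendsto _).comp hx).add (r₁.const_mul β₁)).add (r₂.const_mul β₂)).add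
    (r₃.const_mul β₃)
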